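/- **Setting.** Let $f,h:\mathbb{R}^n\to(-\infty,+\infty]$ be proper lower semicontinuous functions and $g:\mathbb{R}^n\to[0,\infty)$ convex, with $\Omega=\{x: g(x)\ne 0\}\neq\emptyset$. The coordinates of $\mathbb{R}^n$ are partitioned into $N$ blocks, $x_i\in\mathbb{R}^{n_i}$ denotes the $i$-th subvector of $x$, and $f(x)=\sum_{i=1}^N f_i(x_i)$ with each $f_i:\mathbb{R}^{n_i}\to(-\infty,+\infty]$ proper, lower semicontinuous and bounded below. Assume that $f$ is continuous on $\mathrm{dom}(f)$; that $h$ is finite and differentiable on $\Omega$ and every $x\in\Omega$ has a neighbourhood $B$ such that $\nabla h$ is Lipschitz on $B\cap\Omega$; and that $f+h\ge 0$ on $\mathrm{dom}(f)$. Write $\zeta=f+h$, let $g^*$ be the Fenchel conjugate of $g$, $\eta(x,y)=\langle x,y\rangle-g^*(y)\in[-\infty,\infty)$, and $$F(x)=\begin{cases}\zeta(x)/g(x), & x\in\Omega\cap\mathrm{dom}(f),\\ +\infty,&\text{else},\end{cases}\qquad Q(x,y)=\begin{cases}\zeta(x)/\eta(x,y), & x\in\mathrm{dom}(f),\ y\in\mathrm{dom}(g^*),\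 \eta(x,y)>0,\\ +\infty,&\text{else.}\end{cases}$$ For a function $\varphi$ let $\mathrm{prox}_{\varphi}(u)=\arg\min_z\{\varphi(z)+\frac12\|z-u\|^2\}$; let $\partial g$ be the convex subdifferential of $g$, and $\widehat\partial f(x)$ the Fréchet subdifferential of $f$ at $x\in\mathrm{dom}(f)$, i.e. the set of $v$ with $\liminf_{z\to x,\,z\ne x}\frac{f(z)-f(x)-\langle v,z-x\rangle}{\|z-x\|}\ge 0$. A point $x\in\mathrm{dom}(F)$ is a *critical point* of $F$ if $0\in\widehat\partial f(x)+\nabla h(x)-F(x)\,\partial g(x)$. **Cyclic MPGA.** Fix $0<\underline\alpha\le\overline\alpha$, $\sigma>0$, $0<\gamma<1$, an integer $M\ge 0$, $x^{(0)}\in\mathrm{dom}(F)$ and $y^{(0)}\in\partial g(x^{(0)})$. At iteration $t\ge0$ let $Q_{(t)}=Q(x^{(t)},y^{(t)})$, let $l(t)$ be the largest $j\le t$ with $Q_{(j)}=\max\{Q_{(s)}:\max(t-M,0)\le s\le t\}$, and let $i=t \bmod (N+1)$. * If $i=0$: choose $\alpha\in[\underline\alpha,\overline\alpha]$ and set $x^{(t+1)}=x^{(t)}$,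 $y^{(t+1)}=\mathrm{prox}_{\alpha g^*}(y^{(t)}+\alpha x^{(t)})$. * If $1\le i\le N$: choose $\widetilde\alpha\in[\underline\alpha,\overline\alpha]$ and try successively $\alpha=\widetilde\alpha,\widetilde\alpha\gamma,\widetilde\alpha\gamma^2,\dots$: pick $z\in\mathrm{prox}_{\alpha f_i}\big(x^{(t)}_i-\alpha\nabla_i h(x^{(t)})+\alpha Q_{(t)}y^{(t)}_i\big)$ and let $x'$ be $x^{(t)}$ with its $i$-th block replaced by $z$. The first trial point $x'$ with $\zeta(x')+\frac\sigma2\|x'-x^{(t)}\|^2\le Q_{(l(t))}\,\eta(x',y^{(t)})$ is accepted, and $x^{(t+1)}=x'$, $y^{(t+1)}=y^{(t)}$. **Theorem.** Suppose that the level set $\mathcal X=\{x: F(x)\le F(x^{(0)})\}$ is compact, and let $\{(x^{(t)},y^{(t)})\}_{t\ge0}$ be generated by cyclic MPGA. For a constant $\overline g>0$ with $g\le\overline g$ on $\mathcal X$, put $$\mathcal Y=\bigcup\big\{\partial g(z): \mathrm{dist}(z,\mathcal X)^2\le \overline g/\underline\alpha\big\},\qquad \mathcal S=\{(x,y)\in\mathcal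 X\times\mathcal Y:\ \eta(x,y)>0\}.$$ Then $\inf_{t}\eta(x^{(t)},y^{(t)})>0$, and for every accumulation point $(x^\star,y^\star)$ of $\{(x^{(t)},y^{(t)})\}$: 1. $(x^\star,y^\star)\in\mathcal S$, for every such constant $\overline g$; 2. $x^\star\in\mathrm{dom}(F)$ is a critical point of $F$, and $F(x^\star)y^\star\in F(x^\star)\,\partial g(x^\star)$. -/

import Mathlib

open Filter Topology Set
open scoped Pointwise

noncomputable section

/-! ### Convex and variational analysis on Euclidean spaces -/

/-- The Fréchet subdifferential of an extended-real-valued function (empty outside the domain). -/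
def frechetSubdiff {E : Type*} [NormedAddCommGroup E] [InnerProductSpace ℝ E]
    (φ : E → EReal) (x : E) : Set E :=
  {v | φ x < ⊤ ∧
    0 ≤ liminf (fun z => (φ z - φ x - ((inner ℝ v (z - x) : ℝ) : EReal)) / ((‖z - x‖ : ℝ) : EReal))
      (𝓝[≠] x)}

/-- The subdifferential of a real-valued convex function. -/
def convexSubdiff {E : Type*} [NormedAddCommGroup E] [InnerProductSpace ℝ E]
    (g : E → ℝ) (x : E) : Set E :=
  {v | ∀ z, g x + inner ℝ v (z - x) ≤ g z}

/-- The Fenchel conjugate of a real-valued function. -/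
def fenchelConj {E : Type*} [NormedAddCommGroup E] [InnerProductSpace ℝ E]
    (g : E → ℝ) (y : E) : EReal :=
  ⨆ x, ((inner ℝ x y - g x : ℝ) : EReal)

/-- The (set-valued) proximity operator. -/
def prox {E : Type*} [NormedAddCommGroup E] (φ : E → EReal) (x : E) : Set E :=
  {z | ∀ w, φ z + (((1 / 2) * ‖z - x‖ ^ 2 : ℝ) : EReal)
      ≤ φ w + (((1 / 2) * ‖w - x‖ ^ 2 : ℝ) : EReal)}

/-! ### The fractional program -/

/-- Data of the fractional program `min (f x + h x) / g x` over `g x ≠ 0`, with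
`f x = ∑ i, f i (x_i)`. The coordinates of `ℝⁿ` are partitioned into `N` blocks: coordinate `j`
belongs to block `blk j`. -/
structure FracProgram (n N : ℕ) where
  blk : Fin n → Fin N
  fblk : (i : Fin N) → EuclideanSpace ℝ {j : Fin n // blk j = i} → EReal
  h : EuclideanSpace ℝ (Fin n) → EReal
  g : EuclideanSpace ℝ (Fin n) → ℝ

namespace FracProgram

/-- The subvector `x_i` of `x`. -/
def sub {n N : ℕ} (P : FracProgram n N) (i : Fin N) (x : EuclideanSpace ℝ (Fin n)) :
    EuclideanSpace ℝ {j : Fin n // P.blk j = i} :=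
  WithLp.toLp 2 (fun j => x j.1)

/-- The vector obtained from `x` by replacing its `i`-th subvector by `z`. -/
def replace {n N : ℕ} (P : FracProgram n N) (i : Fin N) (x : EuclideanSpace ℝ (Fin n))
    (z : EuclideanSpace ℝ {j : Fin n // P.blk j = i}) : EuclideanSpace ℝ (Fin n) :=
  WithLp.toLp 2 (fun j => if hj : P.blk j = i then z ⟨j, hj⟩ else x j)

/-- The block-separable function `f`. -/
def f {n N : ℕ} (P : FracProgram n N) (x : EuclideanSpace ℝ (Fin n)) : EReal :=
  ∑ i, P.fblk i (P.sub i x)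

/-- `Ω = {x | g x ≠ 0}`. -/
def Omega {n N : ℕ} (P : FracProgram n N) : Set (EuclideanSpace ℝ (Fin n)) :=
  {x | P.g x ≠ 0}

/-- The gradient of `h` (meaningful on `Ω`, where `h` is finite and differentiable). -/
def gradH {n N : ℕ} (P : FracProgram n N) (x : EuclideanSpace ℝ (Fin n)) :
    EuclideanSpace ℝ (Fin n) :=
  gradient (fun z => (P.h z).toReal) x

/-- The numerator `ζ = f + h`. -/
def zeta {n N : ℕ} (P : FracProgram n N) (x : EuclideanSpace ℝ (Fin n)) : EReal :=
  P.f x + P.h x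

/-- The standing assumptions on the fractional program. -/
structure Standing {n N : ℕ} (P : FracProgram n N) : Prop where
  fblk_ne_bot : ∀ i u, P.fblk i u ≠ ⊥
  fblk_proper : ∀ i, ∃ u, P.fblk i u ≠ ⊤
  fblk_lsc : ∀ i, LowerSemicontinuous (P.fblk i)
  fblk_bddBelow : ∀ i, ∃ m : ℝ, ∀ u, (m : EReal) ≤ P.fblk i u
  f_continuousOn : ContinuousOn P.f {x | P.f x < ⊤}
  h_ne_bot : ∀ x, P.h x ≠ ⊥
  h_proper : ∃ x, P.h x ≠ ⊤
  h_lsc : LowerSemicontinuous P.h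
  h_finite : ∀ x ∈ P.Omega, P.h x ≠ ⊤
  h_differentiable : ∀ x ∈ P.Omega, DifferentiableAt ℝ (fun z => (P.h z).toReal) x
  h_gradLip : ∀ x ∈ P.Omega, ∃ U ∈ 𝓝 x, ∃ L : ℝ, ∀ u ∈ U ∩ P.Omega, ∀ v ∈ U ∩ P.Omega,
    ‖P.gradH u - P.gradH v‖ ≤ L * ‖u - v‖
  g_convex : ConvexOn ℝ univ P.g
  g_nonneg : ∀ x, 0 ≤ P.g x
  Omega_nonempty : P.Omega.Nonempty
  zeta_nonneg : ∀ x, P.f x < ⊤ → 0 ≤ P.zeta x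

open Classical in
/-- The extended objective `F`. -/
def F {n N : ℕ} (P : FracProgram n N) (x : EuclideanSpace ℝ (Fin n)) : EReal :=
  if x ∈ P.Omega ∧ P.f x < ⊤ then P.zeta x / ((P.g x : ℝ) : EReal) else ⊤

/-- `η(x, y) = ⟨x, y⟩ - g*(y)`. -/
def eta {n N : ℕ} (P : FracProgram n N) (x y : EuclideanSpace ℝ (Fin n)) : EReal :=
  ((inner ℝ x y : ℝ) : EReal) - fenchelConj P.g y

open Classical in
/-- The extended objective `Q` of the reformulated problem. -/
def Q {n N : ℕ} (P : FracProgram n N) (x y : EuclideanSpace ℝ (Fin n)) : EReal :=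
  if P.f x < ⊤ ∧ fenchelConj P.g y < ⊤ ∧ 0 < P.eta x y then P.zeta x / P.eta x y else ⊤

/-- `x` is a critical point of `F`: `x ∈ dom F` and `0 ∈ ∂̂f(x) + ∇h(x) - F(x) ∂g(x)`. -/
def IsCritical {n N : ℕ} (P : FracProgram n N) (x : EuclideanSpace ℝ (Fin n)) : Prop :=
  P.F x < ⊤ ∧
    (0 : EuclideanSpace ℝ (Fin n)) ∈
      frechetSubdiff P.f x + {P.gradH x} - (P.F x).toReal • convexSubdiff P.g x

/-- The level set `𝒳 = {x | F x ≤ F x₀}`. -/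
def levelSet {n N : ℕ} (P : FracProgram n N) (x₀ : EuclideanSpace ℝ (Fin n)) :
    Set (EuclideanSpace ℝ (Fin n)) :=
  {x | P.F x ≤ P.F x₀}

/-- `𝒴 = ⋃ ∂g(z)` over all `z` with `dist(z, 𝒳)² ≤ gbar / αlo`. -/
def setY {n N : ℕ} (P : FracProgram n N) (x₀ : EuclideanSpace ℝ (Fin n)) (αlo gbar : ℝ) :
    Set (EuclideanSpace ℝ (Fin n)) :=
  ⋃ z ∈ {z | Metric.infDist z (P.levelSet x₀) ^ 2 ≤ gbar / αlo}, convexSubdiff P.g z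

/-- `𝒮 = {(x, y) ∈ 𝒳 × 𝒴 | η(x, y) > 0}`. -/
def setS {n N : ℕ} (P : FracProgram n N) (x₀ : EuclideanSpace ℝ (Fin n)) (αlo gbar : ℝ) :
    Set (EuclideanSpace ℝ (Fin n) × EuclideanSpace ℝ (Fin n)) :=
  {p | p.1 ∈ P.levelSet x₀ ∧ p.2 ∈ P.setY x₀ αlo gbar ∧ 0 < P.eta p.1 p.2}

/-! ### The cyclic multi-proximity gradient algorithm -/

open Classical in
/-- `l(t)`: the largest `j ≤ t` with `q j = max {q s | [t - M]₊ ≤ s ≤ t}`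
(truncated subtraction is intended). -/
def lastMax (M : ℕ) (q : ℕ → EReal) (t : ℕ) : ℕ :=
  Nat.findGreatest (fun j => q j = (Finset.Icc (t - M) t).sup q) t

theorem lastMax_spec (M : ℕ) (q : ℕ → EReal) (t : ℕ) :
    q (lastMax M q t) = (Finset.Icc (t - M) t).sup q := by
  classical
  obtain ⟨j, hj, hq⟩ := Finset.exists_mem_eq_sup (Finset.Icc (t - M) t)
    ⟨t, Finset.mem_Icc.2 ⟨Nat.sub_le t M, le_rfl⟩⟩ q
  exact Nat.findGreatest_spec (P := fun j => q j = (Finset.Icc (t - M) t).sup q)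
    (Finset.mem_Icc.1 hj).2 hq.symm

/-- Step 2-Y: one proximity step of `g*` with step size in `[αlo, αhi]`. -/
def StepY {n N : ℕ} (P : FracProgram n N) (αlo αhi : ℝ)
    (x y x' y' : EuclideanSpace ℝ (Fin n)) : Prop :=
  ∃ α ∈ Icc αlo αhi,
    x' = x ∧ y' ∈ prox (fun v => (α : EReal) * fenchelConj P.g v) (y + α • x)

/-- The candidates for the new `i`-th block with step size `α`:
`prox_{α f_i}(x_i - α ∇_i h(x) + α Q(x, y) y_i)`. -/
def candidates {n N : ℕ} (P : FracProgram n N) (i : Fin N) (α : ℝ)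
    (x y : EuclideanSpace ℝ (Fin n)) : Set (EuclideanSpace ℝ {j : Fin n // P.blk j = i}) :=
  prox (fun v => (α : EReal) * P.fblk i v)
    (P.sub i x - α • P.sub i (P.gradH x) + (α * (P.Q x y).toReal) • P.sub i y)

/-- The line-search test for a trial point `x'`, with reference value `c`. -/
def Accepts {n N : ℕ} (P : FracProgram n N) (σ : ℝ) (c : EReal)
    (x y x' : EuclideanSpace ℝ (Fin n)) : Prop :=
  P.zeta x' + ((σ / 2 * ‖x' - x‖ ^ 2 : ℝ) : EReal) ≤ c * P.eta x' y

/-- Step 2-X for block `i`: starting from some `α ∈ [αlo, αhi]`, the trial step sizes are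
`α, α γ, α γ², …`; the trial points `z 0, …, z (J - 1)` are rejected and `z J` is accepted. -/
def StepX {n N : ℕ} (P : FracProgram n N) (αlo αhi σ γ : ℝ) (i : Fin N) (c : EReal)
    (x y x' y' : EuclideanSpace ℝ (Fin n)) : Prop :=
  ∃ α ∈ Icc αlo αhi, ∃ J : ℕ, ∃ z : ℕ → EuclideanSpace ℝ {j : Fin n // P.blk j = i},
    (∀ j ≤ J, z j ∈ P.candidates i (α * γ ^ j) x y) ∧
    (∀ j < J, ¬ P.Accepts σ c x y (P.replace i x (z j))) ∧
    P.Accepts σ c x y (P.replace i x (z J)) ∧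
    x' = P.replace i x (z J) ∧ y' = y

/-- `(x t, y t)` is generated by the cyclic algorithm: at iteration `t` the block
`t mod (N + 1)` is updated, where `0` stands for `y` and `i + 1` for the `i`-th block of `x`
(blocks being indexed from `0`). -/
structure IsCyclicMPGA {n N : ℕ} (P : FracProgram n N) (αlo αhi σ γ : ℝ) (M : ℕ)
    (x y : ℕ → EuclideanSpace ℝ (Fin n)) : Prop where
  init_x : P.F (x 0) < ⊤
  init_y : y 0 ∈ convexSubdiff P.g (x 0)
  step_y : ∀ t, t % (N + 1) = 0 → P.StepY αlo αhi (x t) (y t) (x (t + 1)) (y (t + 1))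
  step_x : ∀ t, ∀ i : Fin N, t % (N + 1) = i.1 + 1 →
    P.StepX αlo αhi σ γ i
      (P.Q (x (lastMax M (fun s => P.Q (x s) (y s)) t))
        (y (lastMax M (fun s => P.Q (x s) (y s)) t)))
      (x t) (y t) (x (t + 1)) (y (t + 1))

end FracProgram

end

/-!
Every accepted step satisfies `Q(x', y') ≤ Q_{(l(t))}`, so the iterates stay in the compact level
set `𝒳`. A `y`-step lands on a subgradient of `g` at a point `w = x + α⁻¹ (y - y')`
(`mem_convexSubdiff_of_mem_prox`) and raises `η` by at least `α⁻¹ ‖y - y'‖ ^ 2`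
(`FracProgram.StepY.spec`); since `η ≤ g`, this puts `w` at squared distance at most `gbar / αlo`
from `𝒳`, so all `y t` lie in the bounded set `𝒴`. The same estimate bounds `η` below after a
`y`-step: if `η(x, y')` is small then `w` is close to `x`, and `η(x, y')` is close to `g x`. An
`x`-step leading to a small `η` is short, so it cannot destroy this bound
(`FracProgram.IsCyclicMPGA.exists_pos_le_etaR`).

The values `Q_{(t)}` converge by a nonmonotone descent argument (`exists_tendsto_of_nonmonotone`),
which uses that `ζ` is uniformly continuous on `𝒳`. Hence the `x`-steps tend to zero, and so do the
`y`-steps when the limit `L` of the values is positive.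

Let `(xs, ys)` be an accumulation point. If `ζ xs = 0`, then `xs` is a global minimizer of `f + h`,
and it is critical for that reason alone. Otherwise `L > 0`, and `(xs, ys)` is an accumulation
point along each residue class of indices modulo `N + 1` (`exists_ultrafilter_mod_eq`). Along the
`y`-steps `w` tends to `xs`, so that `ys ∈ ∂g(xs)` and `L = F xs`. Along the steps in block `i` the
accepted step sizes are bounded below, because small step sizes always pass the line-search test
near `xs` (`FracProgram.IsCyclicMPGA.exists_forall_accepts`); the proximal inequality then passes
to the limit and shows that `-(∇h(xs) - F(xs) ys)` is a proximal subgradient of `f` in block `i`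
(`FracProgram.IsCyclicMPGA.exists_fblk_le`). The blocks add up to a Fréchet subgradient of `f`
(`FracProgram.Standing.neg_mem_frechetSubdiff`).

Limits along ultrafilters replace subsequences: every bounded sequence converges along an
ultrafilter. The conjugate `g*` is only lower semicontinuous, but `η` is continuous along the
iterates because `g*(y) = ⟨w, y⟩ - g(w)` for `y ∈ ∂g(w)` (`FracProgram.tendsto_etaR`).
-/

noncomputable section

/-! ### Subgradients and the Fenchel conjugate of a finite convex function -/

section Convex

variable {E : Type*} [NormedAddCommGroup E] [InnerProductSpace ℝ E]

/-- A finite convex function on a finite-dimensional space has a subgradient at every point: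
separate `(x, g x)` from the open strict epigraph. -/
theorem convexSubdiff_nonempty [FiniteDimensional ℝ E] {g : E → ℝ} (hg : ConvexOn ℝ univ g)
    (x : E) : (convexSubdiff g x).Nonempty := by
  have hgc : Continuous g := hg.locallyLipschitz.continuous
  have hopen : IsOpen {p : E × ℝ | p.1 ∈ univ ∧ g p.1 < p.2} := by
    simpa using isOpen_lt (hgc.comp continuous_fst) continuous_snd
  obtain ⟨l, hl⟩ := geometric_hahn_banach_open_point (x := (x, g x)) hg.convex_strict_epigraph hopen
    (by simp)
  set b : ℝ := l (0, 1)
  set a : StrongDual ℝ E := l.comp (ContinuousLinearMap.inl ℝ E ℝ)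
  have hdec : ∀ z t, l (z, t) = a z + t * b := by
    intro z t
    have : ((z, t) : E × ℝ) = (z, 0) + t • ((0 : E), (1 : ℝ)) := by simp
    rw [this, map_add, map_smul]; rfl
  have hb : b < 0 := by
    have := hl (x, g x + 1) (by simp)
    rw [hdec, hdec] at this
    linarith
  have hle : ∀ z, a z + g z * b ≤ a x + g x * b := by
    intro z
    refine le_of_forall_pos_lt_add fun ε hε => ?_
    have h1 := hl (z, g z + ε / (-b)) (by simpa using div_pos hε (neg_pos.2 hb))
    rw [hdec, hdec] at h1
    have h2 : ε / (-b) * b = -ε := by field_simp [hb.ne]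
    linarith [add_mul (g z) (ε / (-b)) b]
  have := FiniteDimensional.complete ℝ E
  refine ⟨(-b)⁻¹ • (InnerProductSpace.toDual ℝ E).symm a, fun z => ?_⟩
  rw [real_inner_smul_left, InnerProductSpace.toDual_symm_apply, map_sub]
  have h3 := hle z
  have h4 : (-b)⁻¹ * (a z - a x) ≤ (-b)⁻¹ * ((-b) * (g z - g x)) :=
    mul_le_mul_of_nonneg_left (by linarith) (inv_nonneg.2 (neg_pos.2 hb).le)
  rw [inv_mul_cancel_left₀ (neg_pos.2 hb).ne'] at h4
  linarith

theorem inner_sub_le_fenchelConj (g : E → ℝ) (x y : E) :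
    ((inner ℝ x y - g x : ℝ) : EReal) ≤ fenchelConj g y :=
  le_iSup (fun x => ((inner ℝ x y - g x : ℝ) : EReal)) x

theorem fenchelConj_ne_bot (g : E → ℝ) (y : E) : fenchelConj g y ≠ ⊥ := fun h => by
  have := inner_sub_le_fenchelConj g 0 y
  rw [h, le_bot_iff] at this
  exact EReal.coe_ne_bot _ this

/-- Equality in the Fenchel–Young inequality. -/
theorem fenchelConj_eq_of_mem {g : E → ℝ} {w y : E} (h : y ∈ convexSubdiff g w) :
    fenchelConj g y = ((inner ℝ w y - g w : ℝ) : EReal) := by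
  refine le_antisymm (iSup_le fun x => ?_) (inner_sub_le_fenchelConj g w y)
  have := h x
  rw [inner_sub_right, real_inner_comm, real_inner_comm w] at this
  exact EReal.coe_le_coe_iff.2 (by linarith)

theorem mem_convexSubdiff_of_fenchelConj_le {g : E → ℝ} {w y : E}
    (h : fenchelConj g y ≤ ((inner ℝ w y - g w : ℝ) : EReal)) : y ∈ convexSubdiff g w := by
  intro z
  have := EReal.coe_le_coe_iff.1 ((inner_sub_le_fenchelConj g z y).trans h)
  rw [inner_sub_right, real_inner_comm, real_inner_comm w]
  linarith

/-- Convexity of the conjugate, in terms of real upper bounds at the end points. -/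
theorem fenchelConj_convex_le {g : E → ℝ} {y v : E} {a b s : ℝ} (hs0 : 0 ≤ s) (hs1 : s ≤ 1)
    (ha : fenchelConj g y ≤ a) (hb : fenchelConj g v ≤ b) :
    fenchelConj g (y + s • (v - y)) ≤ (((1 - s) * a + s * b : ℝ) : EReal) := by
  refine iSup_le fun x => EReal.coe_le_coe_iff.2 ?_
  have h1 := EReal.coe_le_coe_iff.1 ((inner_sub_le_fenchelConj g x y).trans ha)
  have h2 := EReal.coe_le_coe_iff.1 ((inner_sub_le_fenchelConj g x v).trans hb)
  rw [inner_add_right, real_inner_smul_right, inner_sub_right]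
  nlinarith [mul_le_mul_of_nonneg_left h1 (sub_nonneg.2 hs1), mul_le_mul_of_nonneg_left h2 hs0]

/-- A proximal step for `g*` lands on a subgradient of `g`: the optimality condition
`(u - y') / α ∈ ∂g*(y')` is inverted with the help of a subgradient of `g` at `(u - y') / α`. -/
theorem mem_convexSubdiff_of_mem_prox [FiniteDimensional ℝ E] {g : E → ℝ} (hg : ConvexOn ℝ univ g)
    {α : ℝ} (hα : 0 < α) {u y' : E}
    (hy' : y' ∈ prox (fun v => (α : EReal) * fenchelConj g v) u) :
    y' ∈ convexSubdiff g (α⁻¹ • (u - y')) := by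
  set w := α⁻¹ • (u - y') with hw
  obtain ⟨v, hv⟩ := convexSubdiff_nonempty hg w
  have hvr := fenchelConj_eq_of_mem hv
  set b : ℝ := inner ℝ w v - g w
  have hfin : fenchelConj g y' ≠ ⊤ := by
    intro htop
    have := hy' v
    simp only [htop, hvr, EReal.coe_mul_top_of_pos hα, EReal.top_add_coe, ← EReal.coe_mul,
      ← EReal.coe_add] at this
    exact EReal.coe_ne_top _ (top_le_iff.1 this)
  obtain ⟨a, ha⟩ : ∃ a : ℝ, fenchelConj g y' = a :=
    ⟨_, (EReal.coe_toReal hfin (fenchelConj_ne_bot g y')).symm⟩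
  have hp : u - y' = α • w := by rw [hw, smul_inv_smul₀ hα.ne']
  have key : ∀ s : ℝ, 0 < s → s ≤ 1 →
      α * inner ℝ w (v - y') - α * (b - a) ≤ s * ((1 / 2) * ‖v - y'‖ ^ 2) := by
    intro s hs0 hs1
    have h1 := hy' (y' + s • (v - y'))
    have h2 := fenchelConj_convex_le hs0.le hs1 ha.le hvr.le
    have h3 : (α : EReal) * fenchelConj g (y' + s • (v - y'))
        ≤ ((α * ((1 - s) * a + s * b) : ℝ) : EReal) := by
      rw [EReal.coe_mul]
      exact mul_le_mul_of_nonneg_left h2 (EReal.coe_nonneg.2 hα.le)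
    have h4 := h1.trans (add_le_add_left h3 _)
    simp only [ha, ← EReal.coe_mul, ← EReal.coe_add, EReal.coe_le_coe_iff] at h4
    have e1 : y' - u = -(α • w) := by rw [← hp]; abel
    have e2 : y' + s • (v - y') - u = s • (v - y') - α • w := by rw [← hp]; abel
    rw [e1, e2, norm_neg, norm_sub_sq_real, real_inner_smul_left, real_inner_smul_right,
      real_inner_comm, norm_smul s, mul_pow, Real.norm_eq_abs, sq_abs] at h4
    have h5 : s * (α * inner ℝ w (v - y') - α * (b - a)) ≤ s * (s * ((1 / 2) * ‖v - y'‖ ^ 2)) := by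
      linarith
    exact le_of_mul_le_mul_left h5 hs0
  have h0 : α * inner ℝ w (v - y') - α * (b - a) ≤ 0 := by
    have ht : Tendsto (fun s : ℝ => s * ((1 / 2) * ‖v - y'‖ ^ 2)) (𝓝[>] 0) (𝓝 0) := by
      have : Continuous (fun s : ℝ => s * ((1 / 2) * ‖v - y'‖ ^ 2)) := by fun_prop
      simpa using (this.tendsto 0).mono_left nhdsWithin_le_nhds
    refine ge_of_tendsto ht ?_
    filter_upwards [Ioc_mem_nhdsGT (zero_lt_one' ℝ)] with s hs using key s hs.1 hs.2
  apply mem_convexSubdiff_of_fenchelConj_le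
  rw [ha]
  refine EReal.coe_le_coe_iff.2 ?_
  have h6 : α * (inner ℝ w (v - y') - (b - a)) ≤ 0 := by linarith
  have h7 := nonpos_of_mul_nonpos_right h6 hα
  rw [inner_sub_right] at h7
  simp only [b] at h7
  linarith

/-- Subgradients of a nonnegative function at `z` are bounded by the values of the function on the
closed unit ball about `z`. -/
theorem exists_norm_le_of_mem_convexSubdiff {g : E → ℝ} (hg0 : ∀ x, 0 ≤ g x) {z v : E}
    (hv : v ∈ convexSubdiff g z) : ∃ d : E, ‖d‖ ≤ 1 ∧ ‖v‖ ≤ g (z + d) := by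
  refine ⟨‖v‖⁻¹ • v, ?_, ?_⟩
  · rw [norm_smul, norm_inv, norm_norm]
    exact inv_mul_le_one
  · have := hv (z + ‖v‖⁻¹ • v)
    rw [add_sub_cancel_left, real_inner_smul_right, real_inner_self_eq_norm_sq] at this
    have h2 : ‖v‖⁻¹ * ‖v‖ ^ 2 = ‖v‖ := by
      rcases eq_or_ne ‖v‖ 0 with h | h
      · simp [h]
      · field_simp
    linarith [hg0 z]

/-- The graph of the subdifferential is closed. -/
theorem mem_convexSubdiff_of_tendsto {g : E → ℝ} (hgc : Continuous g) {ι : Type*} {l : Filter ι}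
    [l.NeBot] {w v : ι → E} {w₀ v₀ : E} (hw : Tendsto w l (𝓝 w₀)) (hv : Tendsto v l (𝓝 v₀))
    (h : ∀ᶠ i in l, v i ∈ convexSubdiff g (w i)) : v₀ ∈ convexSubdiff g w₀ := by
  intro z
  refine le_of_tendsto (((hgc.tendsto w₀).comp hw).add (hv.inner (tendsto_const_nhds.sub hw))) ?_
  filter_upwards [h] with i hi using hi z

end Convex

/-! ### Fréchet subgradients and first-order expansions -/

section Frechet

variable {E : Type*} [NormedAddCommGroup E] [InnerProductSpace ℝ E]

theorem mem_frechetSubdiff_of_eventually {φ : E → EReal} {x v : E} {a : ℝ} (ha : φ x = a)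
    (h : ∀ ε > 0, ∀ᶠ z in 𝓝 x, ((a + inner ℝ v (z - x) - ε * ‖z - x‖ : ℝ) : EReal) ≤ φ z) :
    v ∈ frechetSubdiff φ x := by
  refine ⟨ha ▸ EReal.coe_lt_top a, ?_⟩
  have key : ∀ ε : ℝ, 0 < ε → ((-ε : ℝ) : EReal) ≤ liminf (fun z =>
      (φ z - φ x - ((inner ℝ v (z - x) : ℝ) : EReal)) / ((‖z - x‖ : ℝ) : EReal)) (𝓝[≠] x) := by
    intro ε hε
    refine le_liminf_of_le (by isBoundedDefault) ?_
    filter_upwards [mem_nhdsWithin_of_mem_nhds (h ε hε), self_mem_nhdsWithin] with z hz hzx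
    have hpos : 0 < ‖z - x‖ := norm_pos_iff.2 (sub_ne_zero.2 hzx)
    rw [EReal.le_div_iff_mul_le (EReal.coe_pos.2 hpos) (EReal.coe_ne_top _), ha, ← EReal.coe_mul]
    induction hc : φ z using EReal.rec with
    | bot => rw [hc] at hz; exact absurd (le_bot_iff.1 hz) (EReal.coe_ne_bot _)
    | top => simp
    | coe r =>
      rw [hc, EReal.coe_le_coe_iff] at hz
      rw [← EReal.coe_sub, ← EReal.coe_sub, EReal.coe_le_coe_iff]
      linarith
  refine EReal.ge_of_forall_gt_iff_ge.1 ?_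
  intro z hz
  have := key (-z) (by have := EReal.coe_neg'.1 hz; linarith)
  simpa using this

/-- A Lipschitz gradient on a convex set yields a quadratic upper bound. -/
theorem le_add_inner_add_mul_sq [CompleteSpace E] {φ : E → ℝ} {s : Set E} (hs : Convex ℝ s) {L : ℝ}
    (hd : ∀ u ∈ s, DifferentiableAt ℝ φ u)
    (hL : ∀ u ∈ s, ∀ v ∈ s, ‖gradient φ u - gradient φ v‖ ≤ L * ‖u - v‖)
    {x z : E} (hx : x ∈ s) (hz : z ∈ s) :
    φ z ≤ φ x + inner ℝ (gradient φ x) (z - x) + |L| * ‖z - x‖ ^ 2 := by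
  have hseg : segment ℝ x z ⊆ s := hs.segment_subset hx hz
  have := (convex_segment x z).norm_image_sub_le_of_norm_fderiv_le' (f := φ) (𝕜 := ℝ)
    (φ := InnerProductSpace.toDual ℝ E (gradient φ x)) (C := |L| * ‖z - x‖)
    (fun u hu => hd u (hseg hu)) ?_ (left_mem_segment ℝ x z) (right_mem_segment ℝ x z)
  · rw [InnerProductSpace.toDual_apply_apply, Real.norm_eq_abs] at this
    nlinarith [le_abs_self (φ z - φ x - inner ℝ (gradient φ x) (z - x))]
  · intro u hu
    have h1 : fderiv ℝ φ u = InnerProductSpace.toDual ℝ E (gradient φ u) := by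
      simp [gradient]
    rw [h1, ← map_sub, LinearIsometryEquiv.norm_map]
    refine (hL u (hseg hu) x hx).trans ?_
    refine mul_le_mul (le_abs_self L) ?_ (norm_nonneg _) (abs_nonneg L)
    rw [← dist_eq_norm, ← dist_eq_norm]
    have := dist_add_dist_of_mem_segment hu
    have h2 := dist_nonneg (x := u) (y := z)
    rw [dist_comm u x, dist_comm z x]
    linarith

end Frechet

/-! ### Proximal points -/

/-- The inequality satisfied by a proximal-gradient point `z` with step size `α`, gradient `v` and
base point `a`, in the form which survives passing to the limit. -/
theorem add_le_add_of_mem_prox {E : Type*} [NormedAddCommGroup E] [InnerProductSpace ℝ E]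
    {φ : E → EReal} (hbot : ∀ u, φ u ≠ ⊥) {α : ℝ} (hα : 0 < α) {a v z : E}
    (hz : z ∈ prox (fun u => (α : EReal) * φ u) (a - α • v)) (w : E) :
    φ z + ((inner ℝ v (z - a) + (2 * α)⁻¹ * ‖z - a‖ ^ 2 : ℝ) : EReal) ≤
      φ w + ((inner ℝ v (w - a) + (2 * α)⁻¹ * ‖w - a‖ ^ 2 : ℝ) : EReal) := by
  have h := hz w
  induction hw : φ w using EReal.rec with
  | bot => exact absurd hw (hbot w)
  | top => rw [EReal.top_add_coe]; exact le_top
  | coe b =>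
    induction hc : φ z using EReal.rec with
    | bot => exact absurd hc (hbot z)
    | top =>
      simp only [hw, hc, EReal.coe_mul_top_of_pos hα, EReal.top_add_coe, ← EReal.coe_mul,
        ← EReal.coe_add] at h
      exact absurd (top_le_iff.1 h) (EReal.coe_ne_top _)
    | coe c =>
      simp only [hw, hc, ← EReal.coe_mul, ← EReal.coe_add, EReal.coe_le_coe_iff] at h ⊢
      have e : ∀ p : E, ‖p - (a - α • v)‖ ^ 2
          = ‖p - a‖ ^ 2 + 2 * α * inner ℝ v (p - a) + α ^ 2 * ‖v‖ ^ 2 := by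
        intro p
        rw [show p - (a - α • v) = (p - a) + α • v by abel, norm_add_sq_real, real_inner_smul_right,
          real_inner_comm, norm_smul, mul_pow, Real.norm_eq_abs, sq_abs]
        ring
      rw [e, e] at h
      have h2 : α * (c + (inner ℝ v (z - a) + (2 * α)⁻¹ * ‖z - a‖ ^ 2))
          ≤ α * (b + (inner ℝ v (w - a) + (2 * α)⁻¹ * ‖w - a‖ ^ 2)) := by
        have e2 : ∀ p : E, α * ((2 * α)⁻¹ * ‖p - a‖ ^ 2) = 1 / 2 * ‖p - a‖ ^ 2 := by
          intro p; field_simp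
        rw [mul_add, mul_add, mul_add, mul_add, e2, e2]
        linarith
      exact le_of_mul_le_mul_left h2 hα

/-! ### Block structure -/

namespace FracProgram

variable {n N : ℕ} (P : FracProgram n N)

@[simp] theorem sub_apply (i : Fin N) (x : EuclideanSpace ℝ (Fin n)) (j : {j // P.blk j = i}) :
    P.sub i x j = x j.1 := rfl

theorem sub_sub (i : Fin N) (x y : EuclideanSpace ℝ (Fin n)) :
    P.sub i (x - y) = P.sub i x - P.sub i y := rfl

theorem sub_smul (i : Fin N) (c : ℝ) (x : EuclideanSpace ℝ (Fin n)) :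
    P.sub i (c • x) = c • P.sub i x := rfl

theorem continuous_sub (i : Fin N) : Continuous (P.sub i) := by
  unfold sub; fun_prop

theorem sub_replace_self (i : Fin N) (x : EuclideanSpace ℝ (Fin n))
    (z : EuclideanSpace ℝ {j : Fin n // P.blk j = i}) : P.sub i (P.replace i x z) = z := by
  ext j
  simp [replace, sub, j.2]

theorem sub_replace_of_ne {i k : Fin N} (hk : k ≠ i) (x : EuclideanSpace ℝ (Fin n))
    (z : EuclideanSpace ℝ {j : Fin n // P.blk j = i}) :
    P.sub k (P.replace i x z) = P.sub k x := by
  ext j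
  have : P.blk j.1 ≠ i := by rw [j.2]; exact hk
  simp [replace, sub, this]

theorem inner_eq_sum (x y : EuclideanSpace ℝ (Fin n)) :
    inner ℝ x y = ∑ i, inner ℝ (P.sub i x) (P.sub i y) := by
  simp only [PiLp.inner_apply, sub_apply]
  exact (Fintype.sum_fiberwise P.blk fun j => inner ℝ (x j) (y j)).symm

theorem norm_sq_eq_sum (x : EuclideanSpace ℝ (Fin n)) :
    ‖x‖ ^ 2 = ∑ i, ‖P.sub i x‖ ^ 2 := by
  simp only [← real_inner_self_eq_norm_sq]
  exact P.inner_eq_sum x x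

theorem inner_replace_sub (i : Fin N) (v x : EuclideanSpace ℝ (Fin n))
    (z : EuclideanSpace ℝ {j : Fin n // P.blk j = i}) :
    inner ℝ v (P.replace i x z - x) = inner ℝ (P.sub i v) (z - P.sub i x) := by
  rw [P.inner_eq_sum, Finset.sum_eq_single i]
  · rw [sub_sub, sub_replace_self]
  · intro k _ hk
    rw [sub_sub, sub_replace_of_ne P hk, sub_self, inner_zero_right]
  · simp

theorem norm_replace_sub (i : Fin N) (x : EuclideanSpace ℝ (Fin n))
    (z : EuclideanSpace ℝ {j : Fin n // P.blk j = i}) :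
    ‖P.replace i x z - x‖ = ‖z - P.sub i x‖ := by
  rw [← sq_eq_sq₀ (norm_nonneg _) (norm_nonneg _), ← real_inner_self_eq_norm_sq,
    inner_replace_sub, sub_sub, sub_replace_self, real_inner_self_eq_norm_sq]

variable {P}

theorem coe_sum_ereal {ι : Type*} (s : Finset ι) (φ : ι → ℝ) :
    ((∑ i ∈ s, φ i : ℝ) : EReal) = ∑ i ∈ s, (φ i : EReal) := by
  classical
  induction s using Finset.induction_on with
  | empty => simp
  | insert a s ha ih => rw [Finset.sum_insert ha, Finset.sum_insert ha, EReal.coe_add, ih]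

theorem sum_ne_bot {ι : Type*} {s : Finset ι} {φ : ι → EReal} (h : ∀ i ∈ s, φ i ≠ ⊥) :
    ∑ i ∈ s, φ i ≠ ⊥ := by
  classical
  induction s using Finset.induction_on with
  | empty => simp
  | insert a s ha ih =>
    rw [Finset.sum_insert ha, EReal.add_ne_bot_iff]
    exact ⟨h a (Finset.mem_insert_self a s), ih fun i hi => h i (Finset.mem_insert_of_mem hi)⟩

namespace Standing

variable (hP : P.Standing)
include hP

theorem f_ne_bot (x : EuclideanSpace ℝ (Fin n)) : P.f x ≠ ⊥ :=
  sum_ne_bot fun i _ => hP.fblk_ne_bot i _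

theorem f_lt_top_iff {x : EuclideanSpace ℝ (Fin n)} :
    P.f x < ⊤ ↔ ∀ i, P.fblk i (P.sub i x) < ⊤ := by
  classical
  constructor
  · intro h i
    by_contra hi
    rw [not_lt_top_iff] at hi
    rw [f, ← Finset.add_sum_erase _ _ (Finset.mem_univ i), hi,
      EReal.top_add_of_ne_bot (sum_ne_bot fun i _ => hP.fblk_ne_bot i _)] at h
    exact lt_irrefl _ h
  · intro h
    have : P.f x = ((∑ i, (P.fblk i (P.sub i x)).toReal : ℝ) : EReal) := by
      rw [f, coe_sum_ereal]
      exact Finset.sum_congr rfl fun i _ =>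
        (EReal.coe_toReal (h i).ne (hP.fblk_ne_bot i _)).symm
    rw [this]
    exact EReal.coe_lt_top _

theorem coe_fblk {x : EuclideanSpace ℝ (Fin n)} (h : P.f x < ⊤) (i : Fin N) :
    (((P.fblk i (P.sub i x)).toReal : ℝ) : EReal) = P.fblk i (P.sub i x) :=
  EReal.coe_toReal (hP.f_lt_top_iff.1 h i).ne (hP.fblk_ne_bot i _)

theorem coe_f {x : EuclideanSpace ℝ (Fin n)} (h : P.f x < ⊤) :
    (((P.f x).toReal : ℝ) : EReal) = P.f x :=
  EReal.coe_toReal h.ne (hP.f_ne_bot x)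

theorem f_toReal {x : EuclideanSpace ℝ (Fin n)} (h : P.f x < ⊤) :
    (P.f x).toReal = ∑ i, (P.fblk i (P.sub i x)).toReal := by
  rw [← EReal.coe_eq_coe_iff, hP.coe_f h, coe_sum_ereal, f]
  exact Finset.sum_congr rfl fun i _ => (hP.coe_fblk h i).symm

theorem f_replace_lt_top {x : EuclideanSpace ℝ (Fin n)} (h : P.f x < ⊤) {i : Fin N}
    {z : EuclideanSpace ℝ {j : Fin n // P.blk j = i}} (hz : P.fblk i z < ⊤) :
    P.f (P.replace i x z) < ⊤ := by
  rw [hP.f_lt_top_iff] at h ⊢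
  intro k
  rcases eq_or_ne k i with rfl | hk
  · rwa [sub_replace_self]
  · rw [sub_replace_of_ne P hk]; exact h k

theorem f_replace_toReal {x : EuclideanSpace ℝ (Fin n)} (h : P.f x < ⊤) {i : Fin N}
    {z : EuclideanSpace ℝ {j : Fin n // P.blk j = i}} (hz : P.fblk i z < ⊤) :
    (P.f (P.replace i x z)).toReal - (P.fblk i z).toReal
      = (P.f x).toReal - (P.fblk i (P.sub i x)).toReal := by
  classical
  rw [hP.f_toReal h, hP.f_toReal (hP.f_replace_lt_top h hz),
    ← Finset.add_sum_erase _ _ (Finset.mem_univ i), ← Finset.add_sum_erase _ _ (Finset.mem_univ i),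
    sub_replace_self, add_sub_cancel_left, add_sub_cancel_left]
  exact Finset.sum_congr rfl fun k hk => by rw [sub_replace_of_ne P (Finset.ne_of_mem_erase hk)]

/-- Proximal optimality of a trial block, with the quadratic terms expanded around `x_i`. -/
theorem candidates_le {i : Fin N} {α : ℝ} (hα : 0 < α) {x y : EuclideanSpace ℝ (Fin n)}
    {z : EuclideanSpace ℝ {j : Fin n // P.blk j = i}} (hz : z ∈ P.candidates i α x y)
    (w : EuclideanSpace ℝ {j : Fin n // P.blk j = i}) :
    P.fblk i z + ((inner ℝ (P.sub i (P.gradH x - (P.Q x y).toReal • y)) (z - P.sub i x)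
        + (2 * α)⁻¹ * ‖z - P.sub i x‖ ^ 2 : ℝ) : EReal) ≤
      P.fblk i w + ((inner ℝ (P.sub i (P.gradH x - (P.Q x y).toReal • y)) (w - P.sub i x)
        + (2 * α)⁻¹ * ‖w - P.sub i x‖ ^ 2 : ℝ) : EReal) := by
  refine add_le_add_of_mem_prox (hP.fblk_ne_bot i) hα ?_ w
  have : P.sub i x - α • P.sub i (P.gradH x - (P.Q x y).toReal • y)
      = P.sub i x - α • P.sub i (P.gradH x) + (α * (P.Q x y).toReal) • P.sub i y := by
    rw [sub_sub, sub_smul, smul_sub, smul_smul]; abel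
  rw [this]
  exact hz

theorem fblk_lt_top_of_candidates {i : Fin N} {α : ℝ} (hα : 0 < α)
    {x y : EuclideanSpace ℝ (Fin n)} (h : P.f x < ⊤)
    {z : EuclideanSpace ℝ {j : Fin n // P.blk j = i}} (hz : z ∈ P.candidates i α x y) :
    P.fblk i z < ⊤ := by
  have := hP.candidates_le hα hz (P.sub i x)
  rw [← hP.coe_fblk h i, ← EReal.coe_add] at this
  by_contra hc
  rw [not_lt_top_iff] at hc
  rw [hc, EReal.top_add_coe] at this
  exact EReal.coe_ne_top _ (top_le_iff.1 this)

/-- The decrease of `f` at a trial point, relative to the linearization of the smooth part. -/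
theorem f_replace_le {i : Fin N} {α : ℝ} (hα : 0 < α) {x y : EuclideanSpace ℝ (Fin n)}
    (h : P.f x < ⊤) {z : EuclideanSpace ℝ {j : Fin n // P.blk j = i}}
    (hz : z ∈ P.candidates i α x y) :
    (P.f (P.replace i x z)).toReal
      + inner ℝ (P.gradH x - (P.Q x y).toReal • y) (P.replace i x z - x)
      + (2 * α)⁻¹ * ‖P.replace i x z - x‖ ^ 2 ≤ (P.f x).toReal := by
  have hzt := hP.fblk_lt_top_of_candidates hα h hz
  have h1 := hP.candidates_le hα hz (P.sub i x)
  rw [← hP.coe_fblk h i, ← EReal.coe_toReal hzt.ne (hP.fblk_ne_bot i z), ← EReal.coe_add,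
    ← EReal.coe_add, EReal.coe_le_coe_iff, ← inner_replace_sub, ← norm_replace_sub] at h1
  simp only [sub_self, inner_zero_right, norm_zero] at h1
  have := hP.f_replace_toReal h hzt
  linarith

end Standing
end FracProgram

/-! ### Real-valued forms of the objective functions -/

namespace FracProgram

variable {n N : ℕ}

/-- The real-valued numerator, which represents `ζ` on `dom f ∩ Ω`. -/
def zetaR (P : FracProgram n N) (x : EuclideanSpace ℝ (Fin n)) : ℝ :=
  (P.f x).toReal + (P.h x).toReal

/-- The real-valued coupling, which represents `η` where `g*` is finite. -/
def etaR (P : FracProgram n N) (x y : EuclideanSpace ℝ (Fin n)) : ℝ :=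
  inner ℝ x y - (fenchelConj P.g y).toReal

/-- The real-valued quotient, which represents `Q` at feasible pairs. -/
def qR (P : FracProgram n N) (x y : EuclideanSpace ℝ (Fin n)) : ℝ :=
  P.zetaR x / P.etaR x y

/-- Pairs `(x, y)` at which `Q` is a quotient of real numbers. The finiteness of `g*` at `y` is
asked for in the stronger form that `y` is a subgradient of `g` somewhere. -/
structure Feasible (P : FracProgram n N) (x y : EuclideanSpace ℝ (Fin n)) : Prop where
  dom : P.f x < ⊤
  mem : ∃ w, y ∈ convexSubdiff P.g w
  eta_pos : 0 < P.etaR x y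

variable {P : FracProgram n N}

theorem etaR_of_mem {w y : EuclideanSpace ℝ (Fin n)} (h : y ∈ convexSubdiff P.g w)
    (x : EuclideanSpace ℝ (Fin n)) : P.etaR x y = P.g w + inner ℝ y (x - w) := by
  rw [etaR, fenchelConj_eq_of_mem h, EReal.toReal_coe, inner_sub_right, real_inner_comm,
    real_inner_comm y w]
  ring

theorem eta_eq {w y : EuclideanSpace ℝ (Fin n)} (h : y ∈ convexSubdiff P.g w)
    (x : EuclideanSpace ℝ (Fin n)) : P.eta x y = P.etaR x y := by
  rw [eta, etaR, fenchelConj_eq_of_mem h, ← EReal.coe_sub, EReal.toReal_coe]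

theorem etaR_le {w y : EuclideanSpace ℝ (Fin n)} (h : y ∈ convexSubdiff P.g w)
    (x : EuclideanSpace ℝ (Fin n)) : P.etaR x y ≤ P.g x := by
  rw [etaR_of_mem h]
  exact h x

theorem etaR_eq_of_mem {x y : EuclideanSpace ℝ (Fin n)} (h : y ∈ convexSubdiff P.g x) :
    P.etaR x y = P.g x := by
  rw [etaR_of_mem h, sub_self, inner_zero_right, add_zero]

theorem etaR_sub (x x' y : EuclideanSpace ℝ (Fin n)) :
    P.etaR x' y - P.etaR x y = inner ℝ y (x' - x) := by
  rw [etaR, etaR, inner_sub_right, real_inner_comm, real_inner_comm x]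
  ring

namespace Standing

variable (hP : P.Standing)
include hP

theorem continuous_g : Continuous P.g := hP.g_convex.locallyLipschitz.continuous

theorem isOpen_Omega : IsOpen P.Omega := isOpen_ne_fun hP.continuous_g continuous_const

theorem g_pos {x : EuclideanSpace ℝ (Fin n)} (hx : x ∈ P.Omega) : 0 < P.g x :=
  lt_of_le_of_ne (hP.g_nonneg x) (Ne.symm hx)

theorem zeta_eq_of_ne_top {x : EuclideanSpace ℝ (Fin n)} (hf : P.f x < ⊤) (hh : P.h x ≠ ⊤) :
    P.zeta x = P.zetaR x := by
  rw [zeta, zetaR, EReal.coe_add, hP.coe_f hf, EReal.coe_toReal hh (hP.h_ne_bot x)]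

theorem zetaR_nonneg_of_ne_top {x : EuclideanSpace ℝ (Fin n)} (hf : P.f x < ⊤)
    (hh : P.h x ≠ ⊤) : 0 ≤ P.zetaR x := by
  have := hP.zeta_nonneg x hf
  rwa [hP.zeta_eq_of_ne_top hf hh, EReal.coe_nonneg] at this

theorem F_eq {x : EuclideanSpace ℝ (Fin n)} (hx : x ∈ P.Omega) (hf : P.f x < ⊤) :
    P.F x = ((P.zetaR x / P.g x : ℝ) : EReal) := by
  rw [F, if_pos ⟨hx, hf⟩, hP.zeta_eq_of_ne_top hf (hP.h_finite x hx), EReal.coe_div]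

theorem F_lt_top_iff {x : EuclideanSpace ℝ (Fin n)} :
    P.F x < ⊤ ↔ x ∈ P.Omega ∧ P.f x < ⊤ := by
  constructor
  · intro h
    by_contra hc
    rw [F, if_neg hc] at h
    exact lt_irrefl _ h
  · rintro ⟨h1, h2⟩
    rw [hP.F_eq h1 h2]
    exact EReal.coe_lt_top _

theorem continuousOn_zetaR : ContinuousOn P.zetaR (P.Omega ∩ {x | P.f x < ⊤}) := by
  intro x hx
  refine ContinuousWithinAt.add ?_ ?_
  · refine ContinuousWithinAt.mono ?_ inter_subset_right
    refine (EReal.continuousOn_toReal (P.f x) ?_).comp (hP.f_continuousOn x hx.2) ?_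
    · simp [hP.f_ne_bot x, (show P.f x < ⊤ from hx.2).ne]
    · intro z hz
      simp [hP.f_ne_bot z, (show P.f z < ⊤ from hz).ne]
  · exact (hP.h_differentiable x hx.1).continuousAt.continuousWithinAt

theorem continuousAt_gradH {x : EuclideanSpace ℝ (Fin n)} (hx : x ∈ P.Omega) :
    ContinuousAt P.gradH x := by
  obtain ⟨U, hU, L, hL⟩ := hP.h_gradLip x hx
  have hxU : x ∈ U ∩ P.Omega := ⟨mem_of_mem_nhds hU, hx⟩
  rw [ContinuousAt, tendsto_iff_norm_sub_tendsto_zero]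
  have hlim : Tendsto (fun z => L * ‖z - x‖) (𝓝 x) (𝓝 0) := by
    have : Continuous fun z => L * ‖z - x‖ := by fun_prop
    simpa using this.tendsto x
  refine squeeze_zero' (Eventually.of_forall fun _ => norm_nonneg _) ?_ hlim
  filter_upwards [hU, hP.isOpen_Omega.mem_nhds hx] with z h1 h2 using hL z ⟨h1, h2⟩ x hxU

/-- Local quadratic upper bound for `h` around a point of `Ω`. -/
theorem exists_h_le {x : EuclideanSpace ℝ (Fin n)} (hx : x ∈ P.Omega) :
    ∃ L : ℝ, 0 ≤ L ∧ ∃ V ∈ 𝓝 x, V ⊆ P.Omega ∧ ∀ u ∈ V, ∀ v ∈ V,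
      (P.h v).toReal ≤ (P.h u).toReal + inner ℝ (P.gradH u) (v - u) + L * ‖v - u‖ ^ 2 := by
  obtain ⟨U, hU, L, hL⟩ := hP.h_gradLip x hx
  obtain ⟨r, hr, hball⟩ := Metric.mem_nhds_iff.1 (inter_mem hU (hP.isOpen_Omega.mem_nhds hx))
  refine ⟨|L|, abs_nonneg L, Metric.ball x r, Metric.ball_mem_nhds x hr,
    fun u hu => (hball hu).2, fun u hu v hv => ?_⟩
  exact le_add_inner_add_mul_sq (φ := fun z => (P.h z).toReal) (convex_ball x r)
    (fun w hw => hP.h_differentiable w (hball hw).2)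
    (fun w hw w' hw' => hL w (hball hw) w' (hball hw')) hu hv

end Standing

namespace Feasible

variable {x y : EuclideanSpace ℝ (Fin n)}

theorem eta_eq (h : P.Feasible x y) (z : EuclideanSpace ℝ (Fin n)) : P.eta z y = P.etaR z y :=
  let ⟨_, hw⟩ := h.mem
  FracProgram.eta_eq hw z

theorem etaR_le (h : P.Feasible x y) (z : EuclideanSpace ℝ (Fin n)) : P.etaR z y ≤ P.g z :=
  let ⟨_, hw⟩ := h.mem
  FracProgram.etaR_le hw z

theorem g_pos (h : P.Feasible x y) : 0 < P.g x := h.eta_pos.trans_le (h.etaR_le x)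

theorem mem_Omega (h : P.Feasible x y) : x ∈ P.Omega := h.g_pos.ne'

theorem zetaR_nonneg (h : P.Feasible x y) (hP : P.Standing) : 0 ≤ P.zetaR x :=
  hP.zetaR_nonneg_of_ne_top h.dom (hP.h_finite x h.mem_Omega)

theorem qR_nonneg (h : P.Feasible x y) (hP : P.Standing) : 0 ≤ P.qR x y :=
  div_nonneg (h.zetaR_nonneg hP) h.eta_pos.le

theorem zetaR_eq (h : P.Feasible x y) : P.zetaR x = P.qR x y * P.etaR x y :=
  (div_mul_cancel₀ _ h.eta_pos.ne').symm

theorem Q_eq (h : P.Feasible x y) (hP : P.Standing) : P.Q x y = P.qR x y := by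
  obtain ⟨w, hw⟩ := h.mem
  rw [Q, if_pos, h.eta_eq, hP.zeta_eq_of_ne_top h.dom (hP.h_finite x h.mem_Omega), qR,
    EReal.coe_div]
  refine ⟨h.dom, ?_, ?_⟩
  · rw [fenchelConj_eq_of_mem hw]
    exact EReal.coe_lt_top _
  · rw [h.eta_eq]
    exact EReal.coe_pos.2 h.eta_pos

theorem F_le (h : P.Feasible x y) (hP : P.Standing) : P.F x ≤ P.qR x y := by
  rw [hP.F_eq h.mem_Omega h.dom, EReal.coe_le_coe_iff]
  exact div_le_div_of_nonneg_left (h.zetaR_nonneg hP) h.eta_pos (h.etaR_le x)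

end Feasible

/-! ### One step of the algorithm -/

/-- The `y`-step increases `η` by a multiple of the squared step length, and its result is a
subgradient of `g` at a point close to `x`. -/
theorem StepY.spec (hP : P.Standing) {αlo αhi : ℝ} (hαlo : 0 < αlo)
    {x y x' y' : EuclideanSpace ℝ (Fin n)} (h : P.StepY αlo αhi x y x' y')
    (hy : ∃ w, y ∈ convexSubdiff P.g w) :
    ∃ α ∈ Icc αlo αhi, x' = x ∧ y' ∈ convexSubdiff P.g (x + α⁻¹ • (y - y')) ∧
      P.etaR x y + α⁻¹ * ‖y - y'‖ ^ 2 ≤ P.etaR x y' := by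
  obtain ⟨α, hα, rfl, hy'⟩ := h
  have hα0 : 0 < α := hαlo.trans_le hα.1
  have hmem := mem_convexSubdiff_of_mem_prox hP.g_convex hα0 hy'
  have e : α⁻¹ • (y + α • x' - y') = x' + α⁻¹ • (y - y') := by
    rw [show y + α • x' - y' = α • x' + (y - y') by abel, smul_add, inv_smul_smul₀ hα0.ne']
  rw [e] at hmem
  refine ⟨α, hα, rfl, hmem, ?_⟩
  obtain ⟨w, hw⟩ := hy
  have h1 := FracProgram.etaR_le hw (x' + α⁻¹ • (y - y'))
  have h2 := etaR_sub (P := P) x' (x' + α⁻¹ • (y - y')) y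
  have h3 := etaR_sub (P := P) x' (x' + α⁻¹ • (y - y')) y'
  have h4 := etaR_eq_of_mem hmem
  rw [add_sub_cancel_left, real_inner_smul_right] at h2 h3
  have h5 : α⁻¹ * ‖y - y'‖ ^ 2 = α⁻¹ * inner ℝ y (y - y') - α⁻¹ * inner ℝ y' (y - y') := by
    rw [← mul_sub, ← inner_sub_left, real_inner_self_eq_norm_sq]
  linarith

/-- An accepted `x`-step from a feasible pair leads to a feasible pair, with sufficient decrease
relative to the reference value. -/
theorem StepX.spec (hP : P.Standing) {αlo αhi σ γ : ℝ} (hαlo : 0 < αlo) (hσ : 0 < σ) (hγ0 : 0 < γ)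
    {i : Fin N} {x y x' y' : EuclideanSpace ℝ (Fin n)} {c : ℝ} (hc : 0 ≤ c)
    (hxy : P.Feasible x y) (h : P.StepX αlo αhi σ γ i c x y x' y') :
    y' = y ∧ P.Feasible x' y' ∧
      P.zetaR x' + σ / 2 * ‖x' - x‖ ^ 2 ≤ c * P.etaR x' y := by
  obtain ⟨α, hα, J, z, hz, -, hacc, rfl, rfl⟩ := h
  have hα0 : 0 < α * γ ^ J := mul_pos (hαlo.trans_le hα.1) (pow_pos hγ0 J)
  have hf := hP.f_replace_lt_top hxy.dom (hP.fblk_lt_top_of_candidates hα0 hxy.dom (hz J le_rfl))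
  set x' := P.replace i x (z J)
  rw [Accepts, hxy.eta_eq, ← EReal.coe_mul] at hacc
  have hh : P.h x' ≠ ⊤ := by
    intro htop
    rw [zeta, htop, EReal.add_top_of_ne_bot (hP.f_ne_bot x'), EReal.top_add_coe] at hacc
    exact EReal.coe_ne_top _ (top_le_iff.1 hacc)
  rw [hP.zeta_eq_of_ne_top hf hh, ← EReal.coe_add, EReal.coe_le_coe_iff] at hacc
  refine ⟨rfl, ⟨hf, hxy.mem, ?_⟩, hacc⟩
  by_contra! hle
  -- If `η(x', y) ≤ 0`, acceptance would force `x' = x`, where `η` is positive.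
  have h1 : c * P.etaR x' y' ≤ 0 := mul_nonpos_of_nonneg_of_nonpos hc hle
  have h2 := hP.zetaR_nonneg_of_ne_top hf hh
  have h3 : σ / 2 * ‖x' - x‖ ^ 2 ≤ 0 := by linarith
  have h4 : ‖x' - x‖ ^ 2 ≤ 0 := nonpos_of_mul_nonpos_right h3 (half_pos hσ)
  have h5 : x' = x := by
    rw [← sub_eq_zero, ← norm_eq_zero]
    exact pow_eq_zero_iff (two_ne_zero) |>.1 (le_antisymm h4 (sq_nonneg _))
  rw [h5] at hle
  exact absurd hxy.eta_pos (not_lt.2 hle)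

end FracProgram

/-! ### Convergence under a nonmonotone decrease condition -/

/-- Let `m t` be the maximum of `q` over the window `[t - M, t]`. If `q (t + 1) ≤ m t`, and `q t`
cannot be much smaller than `q (t + 1)` when `q (t + 1)` is close to `m t`, then `q` and `m`
converge to the same limit. Every window contains an index with `q` at least `lim m`, and this
lower bound is carried back, up to an error, over the at most `M` steps from there to the start of
the window. -/
theorem exists_tendsto_of_nonmonotone {q m : ℕ → ℝ} {M : ℕ} (hq : ∀ t, 0 ≤ q t)
    (hle : ∀ t, ∀ s ∈ Icc (t - M) t, q s ≤ m t) (hex : ∀ t, ∃ s ∈ Icc (t - M) t, q s = m t)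
    (hstep : ∀ t, q (t + 1) ≤ m t)
    (hback : ∀ ε > 0, ∃ δ > 0, ∀ t, m t - q (t + 1) < δ → q (t + 1) - ε < q t) :
    ∃ L, Tendsto q atTop (𝓝 L) ∧ Tendsto m atTop (𝓝 L) := by
  have hqm : ∀ t, q t ≤ m t := fun t => hle t t ⟨Nat.sub_le t M, le_rfl⟩
  have hanti : Antitone m := by
    refine antitone_nat_of_succ_le fun t => ?_
    obtain ⟨s, hs, hsm⟩ := hex (t + 1)
    rw [← hsm]
    rcases hs.2.eq_or_lt with rfl | hlt
    · exact hstep t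
    · exact hle t s ⟨by have := hs.1; omega, by omega⟩
  have hbdd : BddBelow (range m) := ⟨0, by rintro _ ⟨t, rfl⟩; exact (hq t).trans (hqm t)⟩
  have hm := tendsto_atTop_ciInf hanti hbdd
  set L := ⨅ t, m t
  have hL : ∀ t, L ≤ m t := fun t => ciInf_le hbdd t
  refine ⟨L, ?_, hm⟩
  have chain : ∀ j : ℕ, ∀ ε > 0, ∃ δ > 0, ∀ᶠ t in atTop, L - δ < q (t + j) → L - ε < q t := by
    intro j
    induction j with
    | zero => exact fun ε hε => ⟨ε, hε, Eventually.of_forall fun t ht => ht⟩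
    | succ j ih =>
      intro ε hε
      obtain ⟨δ₀, hδ₀, h0⟩ := hback (ε / 2) (half_pos hε)
      obtain ⟨δ, hδ, h1⟩ := ih (min (ε / 2) (δ₀ / 2)) (lt_min (half_pos hε) (half_pos hδ₀))
      refine ⟨δ, hδ, ?_⟩
      filter_upwards [(tendsto_add_atTop_nat 1).eventually h1,
        hm.eventually (gt_mem_nhds (lt_add_of_pos_right L (half_pos hδ₀)))] with t h2 h3 h4
      have h5 := h2 (by rwa [add_assoc, add_comm 1 j])
      have h6 : min (ε / 2) (δ₀ / 2) ≤ ε / 2 := min_le_left _ _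
      have h7 : min (ε / 2) (δ₀ / 2) ≤ δ₀ / 2 := min_le_right _ _
      have h8 := h0 t (by linarith)
      linarith
  have hlow : ∀ ε > 0, ∀ᶠ t in atTop, L - ε < q t := by
    intro ε hε
    have hall : ∀ᶠ t in atTop, ∀ j ∈ Finset.range (M + 1), L ≤ q (t + j) → L - ε < q t := by
      refine (Finset.eventually_all _).2 fun j _ => ?_
      obtain ⟨δ, hδ, h⟩ := chain j ε hε
      filter_upwards [h] with t ht h1 using ht (by linarith)
    filter_upwards [hall] with t ht
    obtain ⟨s, hs, hsm⟩ := hex (t + M)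
    have h1 := hs.1
    have h2 := hs.2
    refine ht (s - t) (Finset.mem_range.2 (by omega)) ?_
    rw [show t + (s - t) = s by omega, hsm]
    exact hL _
  refine tendsto_order.2 ⟨fun a ha => ?_, fun a ha => ?_⟩
  · filter_upwards [hlow (L - a) (by linarith)] with t ht
    linarith
  · filter_upwards [hm.eventually (gt_mem_nhds ha)] with t ht using (hqm t).trans_lt ht

namespace FracProgram

theorem lastMax_le (M : ℕ) (q : ℕ → EReal) (t : ℕ) : lastMax M q t ≤ t := Nat.findGreatest_le t

/-- The index of the block updated at iteration `t`, when this is not a `y`-step. -/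
theorem exists_block (N t : ℕ) (h : t % (N + 1) ≠ 0) : ∃ i : Fin N, t % (N + 1) = i.1 + 1 :=
  ⟨⟨t % (N + 1) - 1, by have := Nat.mod_lt t (show 0 < N + 1 by omega); omega⟩, by simp only; omega⟩

/-! ### Bounds on the level set -/

section Bounds

variable {n N : ℕ} {P : FracProgram n N} {x₀ : EuclideanSpace ℝ (Fin n)}

theorem Standing.levelSet_subset (hP : P.Standing) (h₀ : P.F x₀ < ⊤) :
    P.levelSet x₀ ⊆ P.Omega ∩ {x | P.f x < ⊤} := fun _ hx =>
  hP.F_lt_top_iff.1 (lt_of_le_of_lt hx h₀)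

theorem self_mem_levelSet : x₀ ∈ P.levelSet x₀ := le_rfl (a := P.F x₀)

theorem mem_setY_of_mem_levelSet {αlo gbar : ℝ} (hαlo : 0 < αlo) (hgbar : 0 < gbar)
    {x v : EuclideanSpace ℝ (Fin n)} (hx : x ∈ P.levelSet x₀) (hv : v ∈ convexSubdiff P.g x) :
    v ∈ P.setY x₀ αlo gbar := by
  refine mem_iUnion₂.2 ⟨x, ?_, hv⟩
  rw [mem_ofPred_eq, Metric.infDist_zero_of_mem hx]
  simpa using (div_pos hgbar hαlo).le

theorem exists_norm_le_of_infDist_le (hc : IsCompact (P.levelSet x₀)) (c : ℝ) :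
    ∃ B : ℝ, ∀ w, Metric.infDist w (P.levelSet x₀) ^ 2 ≤ c → ‖w‖ ≤ B := by
  obtain ⟨B, hB⟩ := hc.isBounded.exists_norm_le
  refine ⟨√c + B, fun w hw => ?_⟩
  obtain ⟨p, hp, hd⟩ := hc.exists_infDist_eq_dist ⟨x₀, self_mem_levelSet⟩ w
  rw [hd, dist_eq_norm] at hw
  have h1 : ‖w - p‖ ≤ √c := Real.le_sqrt_of_sq_le hw
  calc ‖w‖ = ‖(w - p) + p‖ := by rw [sub_add_cancel]
    _ ≤ ‖w - p‖ + ‖p‖ := norm_add_le _ _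
    _ ≤ √c + B := add_le_add h1 (hB p hp)

theorem Standing.exists_norm_le_of_mem_setY (hP : P.Standing) (hc : IsCompact (P.levelSet x₀))
    (αlo gbar : ℝ) : ∃ R : ℝ, 0 < R ∧ ∀ v ∈ P.setY x₀ αlo gbar, ‖v‖ ≤ R := by
  obtain ⟨B, hB⟩ := exists_norm_le_of_infDist_le hc (gbar / αlo)
  obtain ⟨R, hR⟩ := (isCompact_closedBall (0 : EuclideanSpace ℝ (Fin n)) (B + 1)).bddAbove_image
    hP.continuous_g.continuousOn
  refine ⟨max R 1, lt_max_of_lt_right one_pos, fun v hv => le_max_of_le_left ?_⟩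
  obtain ⟨w, hw, hvw⟩ := mem_iUnion₂.1 hv
  obtain ⟨d, hd, hvd⟩ := exists_norm_le_of_mem_convexSubdiff hP.g_nonneg hvw
  refine hvd.trans (hR (mem_image_of_mem _ ?_))
  rw [mem_closedBall_zero_iff]
  exact (norm_add_le _ _).trans (add_le_add (hB w hw) hd)

theorem Standing.exists_gbar (hP : P.Standing) (hc : IsCompact (P.levelSet x₀)) :
    ∃ gbar : ℝ, 0 < gbar ∧ ∀ u ∈ P.levelSet x₀, P.g u ≤ gbar := by
  obtain ⟨R, hR⟩ := hc.bddAbove_image hP.continuous_g.continuousOn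
  exact ⟨max R 1, lt_max_of_lt_right one_pos,
    fun u hu => le_max_of_le_left (hR (mem_image_of_mem _ hu))⟩

theorem Standing.exists_pos_le_g (hP : P.Standing) (h₀ : P.F x₀ < ⊤)
    (hc : IsCompact (P.levelSet x₀)) : ∃ c : ℝ, 0 < c ∧ ∀ u ∈ P.levelSet x₀, c ≤ P.g u := by
  obtain ⟨u, hu, hmin⟩ := hc.exists_isMinOn ⟨x₀, self_mem_levelSet⟩ hP.continuous_g.continuousOn
  exact ⟨P.g u, hP.g_pos (hP.levelSet_subset h₀ hu).1, fun v hv => hmin hv⟩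

/-- Points of `𝒴` are subgradients at points of a compact set, which therefore converge along an
ultrafilter, and the graph of the subdifferential is closed. -/
theorem exists_tendsto_of_mem_setY (hP : P.Standing) (hc : IsCompact (P.levelSet x₀))
    {αlo gbar : ℝ} {ι : Type*} (U : Ultrafilter ι) {v : ι → EuclideanSpace ℝ (Fin n)}
    {v₀ : EuclideanSpace ℝ (Fin n)} (hv : Tendsto v U (𝓝 v₀))
    (h : ∀ i, v i ∈ P.setY x₀ αlo gbar) :
    ∃ w : ι → EuclideanSpace ℝ (Fin n), ∃ w₀, (∀ i, v i ∈ convexSubdiff P.g (w i)) ∧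
      Tendsto w U (𝓝 w₀) ∧ v₀ ∈ convexSubdiff P.g w₀ ∧
      Metric.infDist w₀ (P.levelSet x₀) ^ 2 ≤ gbar / αlo := by
  obtain ⟨B, hB⟩ := exists_norm_le_of_infDist_le hc (gbar / αlo)
  choose w hw hvw using fun i => mem_iUnion₂.1 (h i)
  obtain ⟨w₀, -, hw₀⟩ := (isCompact_closedBall (0 : EuclideanSpace ℝ (Fin n)) B).ultrafilter_le_nhds
    (U.map w) (by
      rw [Ultrafilter.coe_map, le_principal_iff]
      exact mem_map.2 (univ_mem' fun i => mem_closedBall_zero_iff.2 (hB _ (hw i))))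
  have hw₀ : Tendsto w U (𝓝 w₀) := hw₀
  refine ⟨w, w₀, hvw, hw₀, mem_convexSubdiff_of_tendsto hP.continuous_g hw₀ hv
    (Eventually.of_forall hvw), ?_⟩
  exact le_of_tendsto ((((Metric.continuous_infDist_pt _).tendsto w₀).comp hw₀).pow 2)
    (Eventually.of_forall hw)

theorem mem_setY_of_tendsto (hP : P.Standing) (hc : IsCompact (P.levelSet x₀)) {αlo gbar : ℝ}
    {ι : Type*} (U : Ultrafilter ι) {v : ι → EuclideanSpace ℝ (Fin n)}
    {v₀ : EuclideanSpace ℝ (Fin n)} (hv : Tendsto v U (𝓝 v₀))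
    (h : ∀ i, v i ∈ P.setY x₀ αlo gbar) : v₀ ∈ P.setY x₀ αlo gbar := by
  obtain ⟨_, w₀, -, -, hm, hd⟩ := exists_tendsto_of_mem_setY hP hc U hv h
  exact mem_iUnion₂.2 ⟨w₀, hd, hm⟩

/-- `η` is continuous along points of `𝒴`, although `g*` is only lower semicontinuous in general. -/
theorem tendsto_etaR (hP : P.Standing) (hc : IsCompact (P.levelSet x₀)) {αlo gbar : ℝ}
    {ι : Type*} (U : Ultrafilter ι) {u v : ι → EuclideanSpace ℝ (Fin n)}
    {u₀ v₀ : EuclideanSpace ℝ (Fin n)} (hu : Tendsto u U (𝓝 u₀)) (hv : Tendsto v U (𝓝 v₀))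
    (h : ∀ i, v i ∈ P.setY x₀ αlo gbar) :
    Tendsto (fun i => P.etaR (u i) (v i)) U (𝓝 (P.etaR u₀ v₀)) := by
  obtain ⟨w, w₀, hvw, hw, hm, -⟩ := exists_tendsto_of_mem_setY hP hc U hv h
  rw [etaR_of_mem hm]
  simp only [fun i => etaR_of_mem (hvw i) (u i)]
  exact ((hP.continuous_g.tendsto w₀).comp hw).add (hv.inner (hu.sub hw))

end Bounds

end FracProgram

namespace FracProgram

/-! ### Invariants of the iteration -/

section Run

variable {n N : ℕ} {P : FracProgram n N} {αlo αhi σ γ : ℝ} {M : ℕ}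
  {x y : ℕ → EuclideanSpace ℝ (Fin n)}

/-- The reference value `Q_{(l(t))}` as a real number. -/
def refR (P : FracProgram n N) (M : ℕ) (x y : ℕ → EuclideanSpace ℝ (Fin n)) (t : ℕ) : ℝ :=
  P.qR (x (lastMax M (fun s => P.Q (x s) (y s)) t)) (y (lastMax M (fun s => P.Q (x s) (y s)) t))

namespace IsCyclicMPGA

variable (hP : P.Standing) (hαlo : 0 < αlo) (hσ : 0 < σ) (hγ0 : 0 < γ)
  (hxy : P.IsCyclicMPGA αlo αhi σ γ M x y)

include hP hxy in
theorem feasible_zero : P.Feasible (x 0) (y 0) := by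
  obtain ⟨h1, h2⟩ := hP.F_lt_top_iff.1 hxy.init_x
  refine ⟨h2, ⟨x 0, hxy.init_y⟩, ?_⟩
  rw [etaR_eq_of_mem hxy.init_y]
  exact hP.g_pos h1

include hP hαlo hσ hγ0 hxy

/-- All iterates are feasible, and the objective never exceeds its initial value. -/
theorem feasible_and_qR_le (t : ℕ) :
    P.Feasible (x t) (y t) ∧ P.qR (x t) (y t) ≤ P.qR (x 0) (y 0) := by
  induction t using Nat.strong_induction_on with
  | _ t ih =>
    rcases t with _ | t
    · exact ⟨feasible_zero hP hxy, le_rfl⟩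
    obtain ⟨hf, hq⟩ := ih t (Nat.lt_succ_self t)
    by_cases ht : t % (N + 1) = 0
    · obtain ⟨α, hα, hx, hy, hη⟩ := (hxy.step_y t ht).spec hP hαlo hf.mem
      have hα0 : 0 < α := hαlo.trans_le hα.1
      have hle : P.etaR (x t) (y t) ≤ P.etaR (x (t + 1)) (y (t + 1)) := by
        rw [hx]
        have : 0 ≤ α⁻¹ * ‖y t - y (t + 1)‖ ^ 2 := by positivity
        linarith
      refine ⟨⟨hx ▸ hf.dom, ⟨_, hy⟩, hf.eta_pos.trans_le hle⟩, le_trans ?_ hq⟩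
      rw [qR, qR]
      refine (div_le_div_of_nonneg_left ?_ hf.eta_pos hle).trans_eq (by rw [hx])
      rw [hx]; exact hf.zetaR_nonneg hP
    · obtain ⟨i, hi⟩ := exists_block N t ht
      have hstep := hxy.step_x t i hi
      obtain ⟨hlf, hlq⟩ := ih _ (Nat.lt_succ_of_le (lastMax_le M (fun s => P.Q (x s) (y s)) t))
      rw [hlf.Q_eq hP] at hstep
      obtain ⟨hy, hf', hdec⟩ := hstep.spec hP hαlo hσ hγ0 (hlf.qR_nonneg hP) hf
      refine ⟨hf', le_trans ?_ hlq⟩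
      rw [qR, div_le_iff₀ hf'.eta_pos, hy]
      have : 0 ≤ σ / 2 * ‖x (t + 1) - x t‖ ^ 2 := by positivity
      linarith

theorem feasible (t : ℕ) : P.Feasible (x t) (y t) :=
  (feasible_and_qR_le hP hαlo hσ hγ0 hxy t).1

theorem refR_nonneg (t : ℕ) : 0 ≤ refR P M x y t :=
  (feasible hP hαlo hσ hγ0 hxy _).qR_nonneg hP

theorem refR_le (t : ℕ) : refR P M x y t ≤ P.qR (x 0) (y 0) :=
  (feasible_and_qR_le hP hαlo hσ hγ0 hxy _).2

theorem qR_le_refR (t : ℕ) : ∀ s ∈ Icc (t - M) t, P.qR (x s) (y s) ≤ refR P M x y t := by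
  intro s hs
  rw [← EReal.coe_le_coe_iff, refR, ← (feasible hP hαlo hσ hγ0 hxy s).Q_eq hP,
    ← (feasible hP hαlo hσ hγ0 hxy _).Q_eq hP]
  have := lastMax_spec M (fun s => P.Q (x s) (y s)) t
  rw [this]
  exact Finset.le_sup (f := fun s => P.Q (x s) (y s)) (Finset.mem_Icc.2 hs)

theorem exists_qR_eq_refR (t : ℕ) : ∃ s ∈ Icc (t - M) t, P.qR (x s) (y s) = refR P M x y t := by
  obtain ⟨j, hj, hq⟩ := Finset.exists_mem_eq_sup (Finset.Icc (t - M) t)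
    ⟨t, Finset.mem_Icc.2 ⟨Nat.sub_le t M, le_rfl⟩⟩ fun s => P.Q (x s) (y s)
  refine ⟨j, Finset.mem_Icc.1 hj, ?_⟩
  rw [← EReal.coe_eq_coe_iff, refR, ← (feasible hP hαlo hσ hγ0 hxy j).Q_eq hP,
    ← (feasible hP hαlo hσ hγ0 hxy _).Q_eq hP, ← hq]
  exact (lastMax_spec M (fun s => P.Q (x s) (y s)) t).symm

theorem step_y_spec {t : ℕ} (ht : t % (N + 1) = 0) :
    ∃ α ∈ Icc αlo αhi, x (t + 1) = x t ∧
      y (t + 1) ∈ convexSubdiff P.g (x t + α⁻¹ • (y t - y (t + 1))) ∧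
      P.etaR (x t) (y t) + α⁻¹ * ‖y t - y (t + 1)‖ ^ 2 ≤ P.etaR (x t) (y (t + 1)) :=
  (hxy.step_y t ht).spec hP hαlo (feasible hP hαlo hσ hγ0 hxy t).mem

theorem step_x_spec {t : ℕ} (ht : t % (N + 1) ≠ 0) :
    y (t + 1) = y t ∧ P.zetaR (x (t + 1)) + σ / 2 * ‖x (t + 1) - x t‖ ^ 2
      ≤ refR P M x y t * P.etaR (x (t + 1)) (y t) := by
  obtain ⟨i, hi⟩ := exists_block N t ht
  have hstep := hxy.step_x t i hi
  rw [(feasible hP hαlo hσ hγ0 hxy _).Q_eq hP] at hstep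
  have := hstep.spec hP hαlo hσ hγ0 (refR_nonneg hP hαlo hσ hγ0 hxy t)
    (feasible hP hαlo hσ hγ0 hxy t)
  exact ⟨this.1, this.2.2⟩

theorem mem_levelSet (t : ℕ) : x t ∈ P.levelSet (x 0) := by
  have h0 := feasible_zero hP hxy
  have h1 := (feasible hP hαlo hσ hγ0 hxy t).F_le hP
  refine h1.trans ((EReal.coe_le_coe_iff.2 (feasible_and_qR_le hP hαlo hσ hγ0 hxy t).2).trans_eq ?_)
  rw [hP.F_eq h0.mem_Omega h0.dom, qR, etaR_eq_of_mem hxy.init_y]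

theorem mem_setY {gbar : ℝ} (hgbar : 0 < gbar) (hg : ∀ u ∈ P.levelSet (x 0), P.g u ≤ gbar)
    (t : ℕ) : y t ∈ P.setY (x 0) αlo gbar := by
  induction t with
  | zero => exact mem_setY_of_mem_levelSet hαlo hgbar self_mem_levelSet hxy.init_y
  | succ t ih =>
    by_cases ht : t % (N + 1) = 0
    · obtain ⟨α, hα, -, hy, hη⟩ := step_y_spec hP hαlo hσ hγ0 hxy ht
      have hα0 : 0 < α := hαlo.trans_le hα.1
      refine mem_iUnion₂.2 ⟨_, ?_, hy⟩
      have hmem := mem_levelSet hP hαlo hσ hγ0 hxy t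
      have h1 : α⁻¹ * ‖y t - y (t + 1)‖ ^ 2 ≤ gbar := by
        linarith [hg _ hmem, (feasible hP hαlo hσ hγ0 hxy t).eta_pos, etaR_le hy (x t)]
      have h2 := Metric.infDist_le_dist_of_mem (x := x t + α⁻¹ • (y t - y (t + 1))) hmem
      rw [dist_eq_norm, add_sub_cancel_left, norm_smul, Real.norm_eq_abs,
        abs_of_pos (inv_pos.2 hα0)] at h2
      calc Metric.infDist (x t + α⁻¹ • (y t - y (t + 1))) (P.levelSet (x 0)) ^ 2
          ≤ (α⁻¹ * ‖y t - y (t + 1)‖) ^ 2 := pow_le_pow_left₀ Metric.infDist_nonneg h2 2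
        _ = (α⁻¹ * ‖y t - y (t + 1)‖ ^ 2) / α := by rw [mul_pow]; field_simp
        _ ≤ gbar / αlo := div_le_div₀ hgbar.le h1 hαlo hα.1
    · rw [(step_x_spec hP hαlo hσ hγ0 hxy ht).1]
      exact ih

/-! ### The values of `η` stay away from zero -/

/-- After a `y`-step, `η` is at least `α⁻¹ ‖y - y'‖ ^ 2`, and it is close to `g x` when `y'` is
close to `y`; an `x`-step which makes `η` small must be short, hence `η` was small before. -/
theorem exists_pos_le_etaR (hc : IsCompact (P.levelSet (x 0))) :
    ∃ δ : ℝ, 0 < δ ∧ ∀ t, δ ≤ P.etaR (x t) (y t) := by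
  obtain ⟨gbar, hgbar, hg⟩ := hP.exists_gbar hc
  obtain ⟨R, hR, hRv⟩ := hP.exists_norm_le_of_mem_setY hc αlo gbar
  obtain ⟨c, hc0, hcg⟩ := hP.exists_pos_le_g hxy.init_x hc
  have hmem := mem_levelSet hP hαlo hσ hγ0 hxy
  have hyR : ∀ t, ‖y t‖ ≤ R := fun t => hRv _ (mem_setY hP hαlo hσ hγ0 hxy hgbar hg t)
  have hf := feasible hP hαlo hσ hγ0 hxy
  set q₀ := P.qR (x 0) (y 0)
  have hq₀ : 0 ≤ q₀ := (hf 0).qR_nonneg hP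
  have key : ∀ k : ℕ, ∃ δ : ℝ, 0 < δ ∧
      ∀ t, t % (N + 1) ≤ k → δ ≤ P.etaR (x (t + 1)) (y (t + 1)) := by
    intro k
    induction k with
    | zero =>
      refine ⟨min (c / 2) (αlo * (c / (4 * R)) ^ 2), by positivity, fun t ht => ?_⟩
      obtain ⟨α, hα, hx, hy, hη⟩ := step_y_spec hP hαlo hσ hγ0 hxy (Nat.le_zero.1 ht)
      have hα0 : 0 < α := hαlo.trans_le hα.1
      rw [hx]
      set r := ‖α⁻¹ • (y t - y (t + 1))‖ with hr
      have hr2 : α⁻¹ * ‖y t - y (t + 1)‖ ^ 2 = α * r ^ 2 := by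
        rw [hr, norm_smul, Real.norm_eq_abs, abs_of_pos (inv_pos.2 hα0), mul_pow]
        field_simp
      have h1 : αlo * r ^ 2 ≤ P.etaR (x t) (y (t + 1)) := by
        have := mul_le_mul_of_nonneg_right hα.1 (sq_nonneg r)
        linarith [(hf t).eta_pos]
      obtain ⟨v, hv⟩ := convexSubdiff_nonempty hP.g_convex (x t)
      have hvR := hRv v (mem_setY_of_mem_levelSet hαlo hgbar (hmem t) hv)
      have h2 := hv (x t + α⁻¹ • (y t - y (t + 1)))
      have h3 := etaR_of_mem hy (x t)
      rw [add_sub_cancel_left] at h2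
      rw [sub_add_cancel_left, inner_neg_right] at h3
      have h4 : |inner ℝ v (α⁻¹ • (y t - y (t + 1)))| ≤ R * r :=
        (abs_real_inner_le_norm _ _).trans (mul_le_mul_of_nonneg_right hvR (norm_nonneg _))
      have h5 : |inner ℝ (y (t + 1)) (α⁻¹ • (y t - y (t + 1)))| ≤ R * r :=
        (abs_real_inner_le_norm _ _).trans
          (mul_le_mul_of_nonneg_right (hyR (t + 1)) (norm_nonneg _))
      -- `η(x, y') = g(w) + ⟨y', x - w⟩` at the point `w` with `y' ∈ ∂g(w)`, and `‖w - x‖ = r`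
      have h6 : c - 2 * (R * r) ≤ P.etaR (x t) (y (t + 1)) := by
        linarith [hcg _ (hmem t), (abs_le.1 h4).1, (abs_le.1 h5).2]
      rcases le_total (2 * (R * r)) (c / 2) with hcase | hcase
      · exact min_le_of_left_le (by linarith)
      · refine min_le_of_right_le (le_trans ?_ h1)
        refine mul_le_mul_of_nonneg_left (pow_le_pow_left₀ (by positivity) ?_ 2) hαlo.le
        rw [div_le_iff₀ (by positivity)]
        linarith
    | succ k ih =>
      obtain ⟨δ, hδ, ih⟩ := ih
      refine ⟨min δ (min (δ / 2) (σ / 2 * (δ / (2 * R)) ^ 2 / (q₀ + 1))), by positivity,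
        fun t ht => ?_⟩
      rcases Nat.lt_or_ge k (t % (N + 1)) with hk | hk
      swap
      · exact min_le_of_left_le (ih t hk)
      refine min_le_of_right_le ?_
      obtain ⟨s, rfl⟩ : ∃ s, t = s + 1 := Nat.exists_eq_succ_of_ne_zero (by rintro rfl; simp at hk)
      have hs : s % (N + 1) ≤ k := by
        have h1 : (s + 1) % (N + 1) = (s % (N + 1) + 1) % (N + 1) := by simp [Nat.add_mod]
        have h2 := Nat.mod_le (s % (N + 1) + 1) (N + 1)
        have h3 := Nat.mod_lt s (show 0 < N + 1 by omega)
        rcases Nat.lt_or_ge (s % (N + 1) + 1) (N + 1) with h4 | h4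
        · rw [Nat.mod_eq_of_lt h4] at h1; omega
        · rw [show s % (N + 1) + 1 = N + 1 by omega, Nat.mod_self] at h1; omega
      have hδs := ih s hs
      obtain ⟨hy, hdec⟩ := step_x_spec hP hαlo hσ hγ0 hxy (t := s + 1) (by omega)
      rw [hy]
      have hpos : 0 < P.etaR (x (s + 1 + 1)) (y (s + 1)) := hy ▸ (hf (s + 1 + 1)).eta_pos
      set d := ‖x (s + 1 + 1) - x (s + 1)‖ with hd
      have h1 : σ / 2 * d ^ 2 ≤ (q₀ + 1) * P.etaR (x (s + 1 + 1)) (y (s + 1)) := by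
        have h2 := (hf (s + 1 + 1)).zetaR_nonneg hP
        have h3 := mul_le_mul_of_nonneg_right
          ((refR_le hP hαlo hσ hγ0 hxy (s + 1)).trans (lt_add_one q₀).le) hpos.le
        linarith
      have h4 : |inner ℝ (y (s + 1)) (x (s + 1 + 1) - x (s + 1))| ≤ R * d :=
        (abs_real_inner_le_norm _ _).trans
          (mul_le_mul_of_nonneg_right (hyR (s + 1)) (norm_nonneg _))
      have h5 := etaR_sub (P := P) (x (s + 1)) (x (s + 1 + 1)) (y (s + 1))
      have h6 : δ - R * d ≤ P.etaR (x (s + 1 + 1)) (y (s + 1)) := by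
        linarith [(abs_le.1 h4).1]
      rcases le_total (R * d) (δ / 2) with hcase | hcase
      · exact min_le_of_left_le (by linarith)
      · refine min_le_of_right_le ?_
        rw [div_le_iff₀ (by positivity), mul_comm (P.etaR _ _)]
        refine le_trans ?_ h1
        refine mul_le_mul_of_nonneg_left (pow_le_pow_left₀ (by positivity) ?_ 2) (by positivity)
        rw [div_le_iff₀ (by positivity)]
        linarith
  obtain ⟨δ, hδ, h⟩ := key N
  refine ⟨min δ (P.etaR (x 0) (y 0)), lt_min hδ (hf 0).eta_pos, fun t => ?_⟩
  rcases t with _ | t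
  · exact min_le_right _ _
  · exact min_le_of_left_le (h t (Nat.lt_succ_iff.1 (Nat.mod_lt t (Nat.succ_pos N))))

/-! ### Convergence of the values and vanishing steps -/

theorem qR_succ_le_refR (t : ℕ) : P.qR (x (t + 1)) (y (t + 1)) ≤ refR P M x y t := by
  have hf := feasible hP hαlo hσ hγ0 hxy
  by_cases ht : t % (N + 1) = 0
  · obtain ⟨α, hα, hx, hy, hη⟩ := step_y_spec hP hαlo hσ hγ0 hxy ht
    have hα0 : 0 < α := hαlo.trans_le hα.1
    refine le_trans ?_ (qR_le_refR hP hαlo hσ hγ0 hxy t t ⟨Nat.sub_le t M, le_rfl⟩)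
    have : 0 ≤ α⁻¹ * ‖y t - y (t + 1)‖ ^ 2 := by positivity
    rw [qR, qR, hx]
    exact div_le_div_of_nonneg_left ((hf t).zetaR_nonneg hP) (hf t).eta_pos (by linarith)
  · obtain ⟨hy, hdec⟩ := step_x_spec hP hαlo hσ hγ0 hxy ht
    rw [qR, div_le_iff₀ (hf (t + 1)).eta_pos, hy]
    have : 0 ≤ σ / 2 * ‖x (t + 1) - x t‖ ^ 2 := by positivity
    linarith

/-- The squared length of an `x`-step is controlled by the gap to the reference value. -/
theorem norm_sub_sq_le {gbar : ℝ} (hg : ∀ u ∈ P.levelSet (x 0), P.g u ≤ gbar) (t : ℕ) :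
    σ / 2 * ‖x (t + 1) - x t‖ ^ 2 ≤ (refR P M x y t - P.qR (x (t + 1)) (y (t + 1))) * gbar := by
  have hf := feasible hP hαlo hσ hγ0 hxy
  have hgap := sub_nonneg.2 (qR_succ_le_refR hP hαlo hσ hγ0 hxy t)
  have hle : P.etaR (x (t + 1)) (y (t + 1)) ≤ gbar :=
    ((hf (t + 1)).etaR_le _).trans (hg _ (mem_levelSet hP hαlo hσ hγ0 hxy (t + 1)))
  have hmul := mul_le_mul_of_nonneg_left hle hgap
  by_cases ht : t % (N + 1) = 0
  · obtain ⟨α, hα, hx, -, -⟩ := step_y_spec hP hαlo hσ hγ0 hxy ht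
    rw [show x (t + 1) - x t = 0 by rw [hx, sub_self], norm_zero]
    have := mul_nonneg hgap (hf (t + 1)).eta_pos.le
    simp only [ne_eq, OfNat.ofNat_ne_zero, not_false_eq_true, zero_pow, mul_zero]
    linarith
  · obtain ⟨hy, hdec⟩ := step_x_spec hP hαlo hσ hγ0 hxy ht
    rw [← hy] at hdec
    have := (hf (t + 1)).zetaR_eq
    rw [sub_mul] at hmul
    linarith

/-- The objective values converge, with the reference values. A `y`-step never increases the value,
and an `x`-step with little decrease is short, hence changes the value little by uniform
continuity. -/
theorem exists_tendsto_qR (hc : IsCompact (P.levelSet (x 0))) :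
    ∃ L, Tendsto (fun t => P.qR (x t) (y t)) atTop (𝓝 L) ∧
      Tendsto (refR P M x y) atTop (𝓝 L) := by
  obtain ⟨gbar, hgbar, hg⟩ := hP.exists_gbar hc
  obtain ⟨R, hR, hRv⟩ := hP.exists_norm_le_of_mem_setY hc αlo gbar
  obtain ⟨η₀, hη₀, hη⟩ := exists_pos_le_etaR hP hαlo hσ hγ0 hxy hc
  have hmem := mem_levelSet hP hαlo hσ hγ0 hxy
  have hyR : ∀ t, ‖y t‖ ≤ R := fun t => hRv _ (mem_setY hP hαlo hσ hγ0 hxy hgbar hg t)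
  have hf := feasible hP hαlo hσ hγ0 hxy
  set q₀ := P.qR (x 0) (y 0)
  have hq₀ : 0 ≤ q₀ := (hf 0).qR_nonneg hP
  refine exists_tendsto_of_nonmonotone (fun t => (hf t).qR_nonneg hP)
    (qR_le_refR hP hαlo hσ hγ0 hxy) (exists_qR_eq_refR hP hαlo hσ hγ0 hxy)
    (qR_succ_le_refR hP hαlo hσ hγ0 hxy) fun ε hε => ?_
  have huc := hc.uniformContinuousOn_of_continuous
    (hP.continuousOn_zetaR.mono (hP.levelSet_subset hxy.init_x))
  obtain ⟨ρ, hρ, hζ⟩ := Metric.uniformContinuousOn_iff.1 huc (ε * η₀ / 2) (by positivity)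
  -- steps shorter than `r` change both `ζ` and `q η` by at most `ε η₀ / 2`
  set r := min ρ (ε * η₀ / (2 * ((q₀ + 1) * R))) with hr
  have hr0 : 0 < r := lt_min hρ (by positivity)
  refine ⟨σ / 2 * r ^ 2 / gbar, by positivity, fun t ht => ?_⟩
  by_cases hty : t % (N + 1) = 0
  · obtain ⟨α, hα, hx, -, hη'⟩ := step_y_spec hP hαlo hσ hγ0 hxy hty
    have hα0 : 0 < α := hαlo.trans_le hα.1
    have h1 : 0 ≤ α⁻¹ * ‖y t - y (t + 1)‖ ^ 2 := by positivity
    have h2 : P.qR (x (t + 1)) (y (t + 1)) ≤ P.qR (x t) (y t) := by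
      rw [qR, qR, hx]
      exact div_le_div_of_nonneg_left ((hf t).zetaR_nonneg hP) (hf t).eta_pos (by linarith)
    linarith
  · obtain ⟨hy, -⟩ := step_x_spec hP hαlo hσ hγ0 hxy hty
    set d := ‖x (t + 1) - x t‖ with hd
    have hdr : d < r := by
      have h1 := norm_sub_sq_le hP hαlo hσ hγ0 hxy hg t
      rw [lt_div_iff₀ hgbar] at ht
      have h2 : σ / 2 * d ^ 2 < σ / 2 * r ^ 2 := by linarith
      exact lt_of_pow_lt_pow_left₀ 2 hr0.le (lt_of_mul_lt_mul_left h2 (by positivity))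
    have h3 : |P.zetaR (x (t + 1)) - P.zetaR (x t)| < ε * η₀ / 2 := by
      have := hζ _ (hmem (t + 1)) _ (hmem t)
        (by rw [dist_eq_norm]; exact hdr.trans_le (min_le_left _ _))
      rwa [Real.dist_eq] at this
    have h4 : |inner ℝ (y t) (x (t + 1) - x t)| ≤ R * d :=
      (abs_real_inner_le_norm _ _).trans (mul_le_mul_of_nonneg_right (hyR t) (norm_nonneg _))
    have h5 := etaR_sub (P := P) (x t) (x (t + 1)) (y t)
    have h6 := (hf t).zetaR_eq
    have h7 := (hf (t + 1)).zetaR_eq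
    have h8 : (q₀ + 1) * (R * d) ≤ ε * η₀ / 2 := by
      have := hdr.le.trans (min_le_right _ _)
      rw [le_div_iff₀ (by positivity)] at this
      linarith
    have h9 : P.qR (x (t + 1)) (y (t + 1)) ≤ q₀ + 1 :=
      ((feasible_and_qR_le hP hαlo hσ hγ0 hxy (t + 1)).2).trans (lt_add_one q₀).le
    have h10 : P.qR (x (t + 1)) (y (t + 1)) * -(inner ℝ (y t) (x (t + 1) - x t))
        ≤ ε * η₀ / 2 := by
      refine le_trans ?_ h8
      exact (mul_le_mul_of_nonneg_left (by linarith [(abs_le.1 h4).1])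
        ((hf (t + 1)).qR_nonneg hP)).trans (mul_le_mul_of_nonneg_right h9 (by positivity))
    -- `(q' - q) η(x, y) = (ζ(x') - ζ(x)) - q' (η(x', y) - η(x, y))`
    have h11 : (P.qR (x (t + 1)) (y (t + 1)) - P.qR (x t) (y t)) * P.etaR (x t) (y t)
        < ε * P.etaR (x t) (y t) := by
      have e : (P.qR (x (t + 1)) (y (t + 1)) - P.qR (x t) (y t)) * P.etaR (x t) (y t)
          = (P.zetaR (x (t + 1)) - P.zetaR (x t))
            + P.qR (x (t + 1)) (y (t + 1)) * -(inner ℝ (y t) (x (t + 1) - x t)) := by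
        rw [h6, h7, ← h5, hy]; ring
      rw [e]
      have := mul_le_mul_of_nonneg_left (hη t) hε.le
      linarith [(abs_lt.1 h3).2]
    have := lt_of_mul_lt_mul_right h11 (hf t).eta_pos.le
    linarith

theorem tendsto_x_sub (hc : IsCompact (P.levelSet (x 0))) :
    Tendsto (fun t => x (t + 1) - x t) atTop (𝓝 0) := by
  obtain ⟨gbar, hgbar, hg⟩ := hP.exists_gbar hc
  obtain ⟨L, hL, hm⟩ := exists_tendsto_qR hP hαlo hσ hγ0 hxy hc
  have h1 : Tendsto (fun t => (refR P M x y t - P.qR (x (t + 1)) (y (t + 1))) * gbar / (σ / 2))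
      atTop (𝓝 0) := by
    have := ((hm.sub (hL.comp (tendsto_add_atTop_nat 1))).mul_const gbar).div_const (σ / 2)
    simpa using this
  rw [tendsto_zero_iff_norm_tendsto_zero]
  have h2 : Tendsto (fun t => ‖x (t + 1) - x t‖ ^ 2) atTop (𝓝 0) := by
    refine squeeze_zero (fun _ => sq_nonneg _) (fun t => ?_) h1
    rw [le_div_iff₀ (by positivity)]
    linarith [norm_sub_sq_le hP hαlo hσ hγ0 hxy hg t]
  have := h2.sqrt
  simpa [Real.sqrt_sq (norm_nonneg _)] using this

/-- In a `y`-step the numerator is fixed, so `q (η' - η) = η' (q - q')`: when the values `q` stay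
away from zero, the increase of `η`, and with it the step length, is controlled by the decrease of
`q`. -/
theorem tendsto_y_sub (hc : IsCompact (P.levelSet (x 0))) {L : ℝ} (hL0 : 0 < L)
    (hL : Tendsto (fun t => P.qR (x t) (y t)) atTop (𝓝 L)) :
    Tendsto (fun t => y (t + 1) - y t) atTop (𝓝 0) := by
  obtain ⟨gbar, hgbar, hg⟩ := hP.exists_gbar hc
  have hf := feasible hP hαlo hσ hγ0 hxy
  have hαhi : 0 ≤ αhi := by
    obtain ⟨α, hα, -⟩ := hxy.step_y 0 (Nat.zero_mod _)
    exact hαlo.le.trans (hα.1.trans hα.2)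
  have h1 : Tendsto (fun t => αhi * gbar * |P.qR (x t) (y t) - P.qR (x (t + 1)) (y (t + 1))|
      / P.qR (x t) (y t)) atTop (𝓝 0) := by
    have := ((hL.sub (hL.comp (tendsto_add_atTop_nat 1))).abs.const_mul (αhi * gbar)).div hL hL0.ne'
    rw [sub_self, abs_zero, mul_zero, zero_div] at this
    exact this
  rw [tendsto_zero_iff_norm_tendsto_zero]
  have h2 : Tendsto (fun t => ‖y (t + 1) - y t‖ ^ 2) atTop (𝓝 0) := by
    refine squeeze_zero' (Eventually.of_forall fun _ => sq_nonneg _) ?_ h1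
    filter_upwards [hL.eventually (lt_mem_nhds hL0)] with t ht
    rw [le_div_iff₀ ht]
    have hnn := abs_nonneg (P.qR (x t) (y t) - P.qR (x (t + 1)) (y (t + 1)))
    by_cases hty : t % (N + 1) = 0
    · obtain ⟨α, hα, hx, -, hη⟩ := step_y_spec hP hαlo hσ hγ0 hxy hty
      have hα0 : 0 < α := hαlo.trans_le hα.1
      have h3 := (hf t).zetaR_eq
      have h4 := (hf (t + 1)).zetaR_eq
      have h5 : P.etaR (x (t + 1)) (y (t + 1)) ≤ gbar :=
        ((hf (t + 1)).etaR_le _).trans (hg _ (mem_levelSet hP hαlo hσ hγ0 hxy (t + 1)))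
      have h6 : ‖y (t + 1) - y t‖ ^ 2
          ≤ αhi * (P.etaR (x t) (y (t + 1)) - P.etaR (x t) (y t)) := by
        have h7 : α⁻¹ * ‖y t - y (t + 1)‖ ^ 2
          ≤ P.etaR (x t) (y (t + 1)) - P.etaR (x t) (y t) := by linarith
        have h8 : 0 ≤ P.etaR (x t) (y (t + 1)) - P.etaR (x t) (y t) :=
          le_trans (by positivity) h7
        rw [inv_mul_le_iff₀ hα0] at h7
        rw [norm_sub_rev]
        exact h7.trans (mul_le_mul_of_nonneg_right hα.2 h8)
      rw [hx] at h4 h5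
      calc ‖y (t + 1) - y t‖ ^ 2 * P.qR (x t) (y t)
          ≤ αhi * (P.etaR (x t) (y (t + 1)) - P.etaR (x t) (y t)) * P.qR (x t) (y t) :=
            mul_le_mul_of_nonneg_right h6 ht.le
        _ = αhi * ((P.qR (x t) (y t) - P.qR (x t) (y (t + 1))) * P.etaR (x t) (y (t + 1))) := by
            linear_combination αhi * h3 - αhi * h4
        _ ≤ αhi * (|P.qR (x t) (y t) - P.qR (x t) (y (t + 1))| * gbar) := by
            refine mul_le_mul_of_nonneg_left ?_ hαhi
            have hpos := (hf (t + 1)).eta_pos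
            rw [hx] at hpos
            exact (mul_le_mul_of_nonneg_right (le_abs_self _) hpos.le).trans
              (mul_le_mul_of_nonneg_left h5 (abs_nonneg _))
        _ = αhi * gbar * |P.qR (x t) (y t) - P.qR (x (t + 1)) (y (t + 1))| := by rw [hx]; ring
    · rw [(step_x_spec hP hαlo hσ hγ0 hxy hty).1, sub_self, norm_zero]
      simp only [ne_eq, OfNat.ofNat_ne_zero, not_false_eq_true, zero_pow, zero_mul]
      rw [(step_x_spec hP hαlo hσ hγ0 hxy hty).1] at hnn
      positivity
  have := h2.sqrt
  simpa [Real.sqrt_sq (norm_nonneg _)] using this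

end IsCyclicMPGA
end Run
end FracProgram

/-! ### Accumulation points along a residue class -/

/-- If consecutive terms of `u` become close, an accumulation point of `u` is an accumulation point
of the terms of `u` with index in any prescribed residue class. -/
theorem exists_ultrafilter_mod_eq {E : Type*} [NormedAddCommGroup E] {u : ℕ → E} {p : E} {N k : ℕ}
    (hk : k ≤ N) (hd : Tendsto (fun t => u (t + 1) - u t) atTop (𝓝 0)) {U : Ultrafilter ℕ}
    (hU : (U : Filter ℕ) ≤ atTop) (hu : Tendsto u U (𝓝 p)) :
    ∃ V : Ultrafilter ℕ, (V : Filter ℕ) ≤ atTop ∧ Tendsto u V (𝓝 p) ∧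
      ∀ᶠ t in (V : Filter ℕ), t % (N + 1) = k := by
  have hshift : ∀ j : ℕ, Tendsto (fun t => u (t + j)) U (𝓝 p) := by
    intro j
    induction j with
    | zero => exact hu
    | succ j ih =>
      have h1 : Tendsto (fun t => u (t + j + 1) - u (t + j)) U (𝓝 0) :=
        (hd.comp (tendsto_add_atTop_nat j)).mono_left hU
      simpa [add_assoc] using ih.add h1
  -- `N ≡ -1` modulo `N + 1`, so `τ t` is the first index from `t` on in the residue class of `k`
  set τ : ℕ → ℕ := fun t => t + (k + N * t) % (N + 1) with hτ
  have hmod : ∀ t, τ t % (N + 1) = k := by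
    intro t
    rw [hτ]
    simp only [Nat.add_mod_mod]
    rw [show t + (k + N * t) = k + (N + 1) * t by ring, Nat.add_mul_mod_self_left]
    exact Nat.mod_eq_of_lt (by omega)
  refine ⟨U.map τ, ?_, ?_, ?_⟩
  · have : Tendsto τ atTop atTop := tendsto_atTop_mono (fun t => Nat.le_add_right t _) tendsto_id
    exact this.mono_left hU
  · rw [Ultrafilter.coe_map, tendsto_map'_iff]
    intro s hs
    have : ∀ᶠ t in (U : Filter ℕ), ∀ j ∈ Finset.range (N + 1), u (t + j) ∈ s :=
      (Finset.eventually_all _).2 fun j _ => hshift j hs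
    exact this.mono fun t ht => ht _ (Finset.mem_range.2 (Nat.mod_lt _ (Nat.succ_pos N)))
  · rw [Ultrafilter.coe_map, eventually_map]
    exact Eventually.of_forall hmod

namespace FracProgram

section Cluster

variable {n N : ℕ} {P : FracProgram n N} {αlo αhi σ γ : ℝ} {M : ℕ}
  {x y : ℕ → EuclideanSpace ℝ (Fin n)} {xs ys : EuclideanSpace ℝ (Fin n)}

/-! ### Criticality -/

theorem Standing.exists_le_f (hP : P.Standing) :
    ∃ m : ℝ, ∀ u, P.f u < ⊤ → m ≤ (P.f u).toReal := by
  choose m hm using hP.fblk_bddBelow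
  refine ⟨∑ i, m i, fun u hu => ?_⟩
  rw [hP.f_toReal hu]
  refine Finset.sum_le_sum fun i _ => EReal.coe_le_coe_iff.1 ?_
  rw [hP.coe_fblk hu]
  exact hm i _

/-- A zero of `ζ` is a global minimizer of `f + h`. -/
theorem Standing.neg_gradH_mem_frechetSubdiff (hP : P.Standing) (hx : xs ∈ P.Omega)
    (hf : P.f xs < ⊤) (h0 : P.zetaR xs = 0) : -P.gradH xs ∈ frechetSubdiff P.f xs := by
  refine mem_frechetSubdiff_of_eventually (hP.coe_f hf).symm fun ε hε => ?_
  have hgrad := ((hP.h_differentiable xs hx).hasGradientAt.hasFDerivAt).isLittleO.def hε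
  filter_upwards [hgrad, hP.isOpen_Omega.mem_nhds hx] with z hz hzΩ
  rcases eq_or_ne (P.f z) ⊤ with htop | htop
  · rw [htop]; exact le_top
  have hfz : P.f z < ⊤ := lt_top_iff_ne_top.2 htop
  rw [← hP.coe_f hfz, EReal.coe_le_coe_iff]
  have h1 := hP.zetaR_nonneg_of_ne_top hfz (hP.h_finite z hzΩ)
  rw [Real.norm_eq_abs, InnerProductSpace.toDual_apply_apply] at hz
  have h2 := (abs_le.1 hz).2
  rw [inner_neg_left]
  rw [zetaR] at h0 h1
  rw [gradH]
  linarith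

/-- Blockwise proximal subgradients add up to a Fréchet subgradient of `f`. -/
theorem Standing.neg_mem_frechetSubdiff (hP : P.Standing) {v : EuclideanSpace ℝ (Fin n)}
    (hf : P.f xs < ⊤)
    (h : ∀ i, ∃ κ : ℝ, 0 ≤ κ ∧ ∀ u, P.fblk i (P.sub i xs) ≤ P.fblk i u
      + ((inner ℝ (P.sub i v) (u - P.sub i xs) + κ * ‖u - P.sub i xs‖ ^ 2 : ℝ) : EReal)) :
    -v ∈ frechetSubdiff P.f xs := by
  choose κ hκ hκu using h
  set K := ∑ i, κ i with hK
  have hglob : ∀ z, P.f z < ⊤ →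
      (P.f xs).toReal ≤ (P.f z).toReal + inner ℝ v (z - xs) + K * ‖z - xs‖ ^ 2 := by
    intro z hz
    rw [hP.f_toReal hf, hP.f_toReal hz, P.inner_eq_sum, P.norm_sq_eq_sum, Finset.mul_sum,
      ← Finset.sum_add_distrib, ← Finset.sum_add_distrib]
    refine Finset.sum_le_sum fun i _ => ?_
    have h1 := hκu i (P.sub i z)
    rw [← hP.coe_fblk hf, ← hP.coe_fblk hz, ← EReal.coe_add, EReal.coe_le_coe_iff] at h1
    have h2 : κ i * ‖P.sub i z - P.sub i xs‖ ^ 2 ≤ K * ‖P.sub i z - P.sub i xs‖ ^ 2 :=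
      mul_le_mul_of_nonneg_right
        (Finset.single_le_sum (fun j _ => hκ j) (Finset.mem_univ i)) (sq_nonneg _)
    rw [sub_sub]
    linarith
  refine mem_frechetSubdiff_of_eventually (hP.coe_f hf).symm fun ε hε => ?_
  have hK0 : 0 ≤ K := Finset.sum_nonneg fun i _ => hκ i
  have hsmall : ∀ᶠ z in 𝓝 xs, K * ‖z - xs‖ < ε := by
    have hcont : Continuous fun z => K * ‖z - xs‖ := by fun_prop
    have := hcont.tendsto xs
    rw [sub_self, norm_zero, mul_zero] at this
    exact this.eventually (gt_mem_nhds hε)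
  filter_upwards [hsmall] with z hz
  rcases eq_or_ne (P.f z) ⊤ with htop | htop
  · rw [htop]; exact le_top
  have hfz : P.f z < ⊤ := lt_top_iff_ne_top.2 htop
  rw [← hP.coe_f hfz, EReal.coe_le_coe_iff, inner_neg_left]
  have h1 := mul_le_mul_of_nonneg_right hz.le (norm_nonneg (z - xs))
  have h2 := hglob z hfz
  rw [sq, ← mul_assoc] at h2
  linarith

theorem isCritical_of_mem (hF : P.F xs < ⊤) {v w : EuclideanSpace ℝ (Fin n)}
    (hv : v ∈ frechetSubdiff P.f xs) (hw : w ∈ convexSubdiff P.g xs)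
    (h : v + P.gradH xs = (P.F xs).toReal • w) : P.IsCritical xs := by
  refine ⟨hF, mem_sub.2 ⟨v + P.gradH xs, add_mem_add hv (mem_singleton _), _,
    smul_mem_smul_set hw, ?_⟩⟩
  rw [h, sub_self]

/-! ### The line search and the optimality conditions at accumulation points -/

namespace IsCyclicMPGA

variable (hP : P.Standing) (hαlo : 0 < αlo) (hσ : 0 < σ) (hγ0 : 0 < γ)
  (hxy : P.IsCyclicMPGA αlo αhi σ γ M x y)

include hP hαlo hσ hγ0 hxy

/-- Near an accumulation point, every sufficiently small step size passes the line-search test: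
small steps lead to nearby points, where the quadratic upper bound for `h` is available. -/
theorem exists_forall_accepts (hc : IsCompact (P.levelSet (x 0))) (hxs : xs ∈ P.levelSet (x 0))
    {V : Filter ℕ} (hx : Tendsto x V (𝓝 xs)) (hy : Tendsto y V (𝓝 ys)) {L : ℝ}
    (hq : Tendsto (fun t => P.qR (x t) (y t)) V (𝓝 L)) (i : Fin N) :
    ∃ β > 0, ∀ᶠ t in V, ∀ α, 0 < α → α ≤ β → ∀ z ∈ P.candidates i α (x t) (y t),
      P.Accepts σ (refR P M x y t) (x t) (y t) (P.replace i (x t) z) := by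
  have hf := feasible hP hαlo hσ hγ0 hxy
  have hdom := hP.levelSet_subset hxy.init_x hxs
  obtain ⟨η₀, hη₀, hη⟩ := exists_pos_le_etaR hP hαlo hσ hγ0 hxy hc
  obtain ⟨m, hm⟩ := hP.exists_le_f
  obtain ⟨Lh, hLh, W, hW, hWΩ, hdesc⟩ := hP.exists_h_le hdom.1
  obtain ⟨ρ₀, hρ₀, hball⟩ := Metric.mem_nhds_iff.1 hW
  set R := ‖ys‖ + 1 with hR
  have hR0 : 0 < R := by positivity
  set ρ := min (ρ₀ / 2) (η₀ / R) with hρ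
  have hρ0 : 0 < ρ := lt_min (half_pos hρ₀) (div_pos hη₀ hR0)
  have hyR : ∀ᶠ t in V, ‖y t‖ ≤ R :=
    (hy.norm.eventually (gt_mem_nhds (lt_add_one ‖ys‖))).mono fun _ h => le_of_lt h
  have hv : Tendsto (fun t => P.gradH (x t) - P.qR (x t) (y t) • y t) V
      (𝓝 (P.gradH xs - L • ys)) :=
    ((hP.continuousAt_gradH hdom.1).tendsto.comp hx).sub (hq.smul hy)
  set B := ‖P.gradH xs - L • ys‖ + 1 with hB
  have hB0 : 0 < B := by positivity
  have hvB : ∀ᶠ t in V, ‖P.gradH (x t) - P.qR (x t) (y t) • y t‖ ≤ B :=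
    (hv.norm.eventually (gt_mem_nhds (lt_add_one _))).mono fun _ h => le_of_lt h
  have hflim : Tendsto (fun t => (P.f (x t)).toReal) V (𝓝 (P.f xs).toReal) := by
    have h1 : Tendsto (fun t => P.zetaR (x t)) V (𝓝 (P.zetaR xs)) :=
      (hP.continuousOn_zetaR xs hdom).tendsto.comp (tendsto_nhdsWithin_iff.2
        ⟨hx, Eventually.of_forall fun t => ⟨(hf t).mem_Omega, (hf t).dom⟩⟩)
    have h2 : Tendsto (fun t => (P.h (x t)).toReal) V (𝓝 (P.h xs).toReal) :=
      (hP.h_differentiable xs hdom.1).continuousAt.tendsto.comp hx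
    simpa [zetaR] using h1.sub h2
  set C := (P.f xs).toReal + 1 - m with hC
  have hC0 : 0 < C := by linarith [hm xs hdom.2]
  have hfC : ∀ᶠ t in V, (P.f (x t)).toReal - m ≤ C := by
    filter_upwards [hflim.eventually (gt_mem_nhds (lt_add_one _))] with t ht
    linarith
  -- the first bound forces trial points to lie within `ρ` of `x t`; the second makes the proximal
  -- term dominate `(Lh + σ / 2) ‖x' - x t‖ ^ 2`
  refine ⟨min (ρ / (4 * (C / ρ + B))) (2 * Lh + σ)⁻¹, by positivity, ?_⟩
  filter_upwards [hyR, hvB, hfC, hx.eventually (Metric.ball_mem_nhds xs (half_pos hρ₀))]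
    with t hyt hvt hft hxt α hα0 hαβ z hz
  have hα1 := hαβ.trans (min_le_left _ _)
  have hα2 := hαβ.trans (min_le_right _ _)
  have hQ : (P.Q (x t) (y t)).toReal = P.qR (x t) (y t) := by rw [(hf t).Q_eq hP, EReal.toReal_coe]
  have hfx' := hP.f_replace_lt_top (hf t).dom (hP.fblk_lt_top_of_candidates hα0 (hf t).dom hz)
  have hprox := hP.f_replace_le hα0 (hf t).dom hz
  rw [hQ] at hprox
  set x' := P.replace i (x t) z
  set v := P.gradH (x t) - P.qR (x t) (y t) • y t with hvdef
  set d := ‖x' - x t‖ with hd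
  have hd0 : 0 ≤ d := norm_nonneg _
  have hvd : |inner ℝ v (x' - x t)| ≤ B * d :=
    (abs_real_inner_le_norm _ _).trans (mul_le_mul_of_nonneg_right hvt hd0)
  have hdρ : d < ρ := by
    by_contra! hle
    have h1 : (2 * α)⁻¹ * d ^ 2 ≤ C + B * d := by linarith [hm x' hfx', (abs_le.1 hvd).1]
    have h2 : C ≤ C / ρ * d := by
      rw [div_mul_eq_mul_div, le_div_iff₀ hρ0]
      exact mul_le_mul_of_nonneg_left hle hC0.le
    rw [inv_mul_le_iff₀ (by positivity)] at h1
    have h3 : d * d ≤ 2 * α * (C / ρ + B) * d := by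
      have := mul_le_mul_of_nonneg_left h2 (show 0 ≤ 2 * α by positivity)
      linarith [sq d]
    have h4 := le_of_mul_le_mul_right h3 (hρ0.trans_le hle)
    rw [le_div_iff₀ (by positivity)] at hα1
    linarith
  have hxW : x t ∈ W := hball (Metric.ball_subset_ball (by linarith) hxt)
  have hx'W : x' ∈ W := by
    refine hball (Metric.mem_ball.2 ?_)
    have h1 : dist x' (x t) < ρ₀ / 2 := by
      rw [dist_eq_norm]; exact hdρ.trans_le (min_le_left _ _)
    linarith [dist_triangle x' (x t) xs, Metric.mem_ball.1 hxt]
  have hh := hdesc _ hxW _ hx'W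
  have hηd : |inner ℝ (y t) (x' - x t)| ≤ R * d :=
    (abs_real_inner_le_norm _ _).trans (mul_le_mul_of_nonneg_right hyt hd0)
  have hRd : R * d ≤ η₀ := by
    have := hdρ.le.trans (min_le_right _ _)
    rw [le_div_iff₀ hR0] at this
    linarith
  have hηsub := etaR_sub (P := P) (x t) x' (y t)
  have hη' : 0 ≤ P.etaR x' (y t) := by linarith [hη t, (abs_le.1 hηd).1]
  have hσL : (Lh + σ / 2) * d ^ 2 ≤ (2 * α)⁻¹ * d ^ 2 := by
    refine mul_le_mul_of_nonneg_right ?_ (sq_nonneg d)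
    rw [le_inv_comm₀ hα0 (by positivity)] at hα2
    rw [mul_inv]
    linarith
  rw [Accepts, (hf t).eta_eq, hP.zeta_eq_of_ne_top hfx' (hP.h_finite x' (hWΩ hx'W)),
    ← EReal.coe_mul, ← EReal.coe_add, EReal.coe_le_coe_iff]
  have hmul := mul_le_mul_of_nonneg_right
    (qR_le_refR hP hαlo hσ hγ0 hxy t t ⟨Nat.sub_le t M, le_rfl⟩) hη'
  have hz1 := (hf t).zetaR_eq
  have hvi : inner ℝ v (x' - x t) = inner ℝ (P.gradH (x t)) (x' - x t)
      - P.qR (x t) (y t) * inner ℝ (y t) (x' - x t) := by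
    rw [hvdef, inner_sub_left, real_inner_smul_left]
  have hq' : P.qR (x t) (y t) * P.etaR x' (y t) = P.zetaR (x t)
      + P.qR (x t) (y t) * inner ℝ (y t) (x' - x t) := by
    rw [hz1, ← hηsub]; ring
  simp only [zetaR] at hq' ⊢
  linarith

/-- Step sizes accepted near an accumulation point are bounded below, so the proximal inequality
passes to the limit and gives a proximal subgradient of `f i`. -/
theorem exists_fblk_le (hc : IsCompact (P.levelSet (x 0)))
    (hxs : xs ∈ P.levelSet (x 0)) {V : Filter ℕ} [V.NeBot] (hV : V ≤ atTop)
    (hx : Tendsto x V (𝓝 xs)) (hy : Tendsto y V (𝓝 ys)) {L : ℝ}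
    (hq : Tendsto (fun t => P.qR (x t) (y t)) V (𝓝 L)) (i : Fin N)
    (hmod : ∀ᶠ t in V, t % (N + 1) = i.1 + 1) :
    ∃ κ : ℝ, 0 ≤ κ ∧ ∀ u, P.fblk i (P.sub i xs) ≤ P.fblk i u
      + ((inner ℝ (P.sub i (P.gradH xs - L • ys)) (u - P.sub i xs)
        + κ * ‖u - P.sub i xs‖ ^ 2 : ℝ) : EReal) := by
  have hf := feasible hP hαlo hσ hγ0 hxy
  have hdom := hP.levelSet_subset hxy.init_x hxs
  obtain ⟨β, hβ, hacc⟩ := exists_forall_accepts hP hαlo hσ hγ0 hxy hc hxs hx hy hq i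
  set a := min αlo (γ * β) with ha
  have ha0 : 0 < a := lt_min hαlo (mul_pos hγ0 hβ)
  refine ⟨(2 * a)⁻¹, by positivity, fun u => ?_⟩
  have hineq : ∀ᶠ t in V, P.fblk i (P.sub i (x (t + 1)))
      + ((inner ℝ (P.sub i (P.gradH (x t) - P.qR (x t) (y t) • y t))
        (P.sub i (x (t + 1)) - P.sub i (x t)) : ℝ) : EReal)
      ≤ P.fblk i u + ((inner ℝ (P.sub i (P.gradH (x t) - P.qR (x t) (y t) • y t))
        (u - P.sub i (x t)) + (2 * a)⁻¹ * ‖u - P.sub i (x t)‖ ^ 2 : ℝ) : EReal) := by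
    filter_upwards [hacc, hmod] with t ht htm
    have hstep := hxy.step_x t i htm
    rw [(hf _).Q_eq hP] at hstep
    obtain ⟨α, hα, J, z, hz, hrej, -, hx', -⟩ := hstep
    have hα0 : 0 < α := hαlo.trans_le hα.1
    have haJ : a ≤ α * γ ^ J := by
      rcases J with _ | J
      · rw [pow_zero, mul_one]
        exact (min_le_left _ _).trans hα.1
      · -- the step size tried just before was rejected, hence exceeds `β`
        have h1 : β < α * γ ^ J := by
          by_contra! hle
          exact hrej J (Nat.lt_succ_self J)
            (ht _ (mul_pos hα0 (pow_pos hγ0 J)) hle _ (hz J (Nat.le_succ J)))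
        refine (min_le_right _ _).trans ?_
        rw [pow_succ, ← mul_assoc, mul_comm]
        exact mul_le_mul_of_nonneg_right h1.le hγ0.le
    have hprox := hP.candidates_le (mul_pos hα0 (pow_pos hγ0 J)) (hz J le_rfl) u
    rw [(hf t).Q_eq hP, EReal.toReal_coe] at hprox
    rw [hx', sub_replace_self]
    refine le_trans (add_le_add_right (EReal.coe_le_coe_iff.2 ?_) _)
      (hprox.trans (add_le_add_right (EReal.coe_le_coe_iff.2 ?_) _))
    · have : 0 ≤ (2 * (α * γ ^ J))⁻¹ * ‖z J - P.sub i (x t)‖ ^ 2 := by positivity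
      linarith
    · gcongr
  induction hu : P.fblk i u using EReal.rec with
  | bot => exact absurd hu (hP.fblk_ne_bot i u)
  | top => rw [EReal.top_add_coe]; exact le_top
  | coe b =>
    rw [← EReal.coe_add]
    have hx1 : Tendsto (fun t => x (t + 1)) V (𝓝 xs) := by
      simpa using ((tendsto_x_sub hP hαlo hσ hγ0 hxy hc).mono_left hV).add hx
    have hsx := ((P.continuous_sub i).tendsto xs).comp hx
    have hsx1 := ((P.continuous_sub i).tendsto xs).comp hx1
    have hv : Tendsto (fun t => P.sub i (P.gradH (x t) - P.qR (x t) (y t) • y t)) V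
        (𝓝 (P.sub i (P.gradH xs - L • ys))) :=
      ((P.continuous_sub i).tendsto _).comp
        (((hP.continuousAt_gradH hdom.1).tendsto.comp hx).sub (hq.smul hy))
    have hl := hv.inner (𝕜 := ℝ) (hsx1.sub hsx)
    have hr := (hv.inner (𝕜 := ℝ) ((tendsto_const_nhds (x := u)).sub hsx)).add
      ((((tendsto_const_nhds (x := u)).sub hsx).norm.pow 2).const_mul (2 * a)⁻¹)
    have hlr := (hr.const_add b).sub hl
    rw [sub_self, inner_zero_right, sub_zero] at hlr
    by_contra! hlt
    obtain ⟨c, hc1, hc2⟩ := EReal.lt_iff_exists_real_btwn.1 hlt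
    have hlsc := hsx1.eventually (hP.fblk_lsc i (P.sub i xs) c hc2)
    refine absurd (EReal.coe_lt_coe_iff.1 hc1) (not_lt.2 (ge_of_tendsto hlr ?_))
    filter_upwards [hlsc, hineq] with t h1 h2
    rw [hu, ← EReal.coe_add] at h2
    have h3 := (add_le_add_left h1.le _).trans h2
    rw [← EReal.coe_add, EReal.coe_le_coe_iff] at h3
    simp only [Function.comp_apply]
    linarith

/-- The results of the `y`-steps are subgradients of `g` at points approaching `xs`. -/
theorem mem_convexSubdiff_of_tendsto {V : Filter ℕ} [V.NeBot] (hx : Tendsto x V (𝓝 xs))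
    (hy : Tendsto y V (𝓝 ys)) (hd : Tendsto (fun t => y (t + 1) - y t) V (𝓝 0))
    (hmod : ∀ᶠ t in V, t % (N + 1) = 0) : ys ∈ convexSubdiff P.g xs := by
  have hw : ∀ t, t % (N + 1) = 0 → ∃ w, y (t + 1) ∈ convexSubdiff P.g w ∧
      ‖w - x t‖ ≤ αlo⁻¹ * ‖y (t + 1) - y t‖ := by
    intro t ht
    obtain ⟨α, hα, -, hm, -⟩ := step_y_spec hP hαlo hσ hγ0 hxy ht
    refine ⟨_, hm, ?_⟩
    have hα0 : 0 < α := hαlo.trans_le hα.1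
    rw [add_sub_cancel_left, norm_smul, Real.norm_eq_abs, abs_of_pos (inv_pos.2 hα0), norm_sub_rev]
    exact mul_le_mul_of_nonneg_right (inv_anti₀ hαlo hα.1) (norm_nonneg _)
  choose! w hwm hwx using hw
  have hy1 : Tendsto (fun t => y (t + 1)) V (𝓝 ys) := by simpa using hd.add hy
  have hwlim : Tendsto w V (𝓝 xs) := by
    have h0 : Tendsto (fun t => w t - x t) V (𝓝 0) := by
      rw [tendsto_zero_iff_norm_tendsto_zero]
      have := hd.norm.const_mul αlo⁻¹
      rw [norm_zero, mul_zero] at this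
      exact squeeze_zero' (Eventually.of_forall fun _ => norm_nonneg _)
        (hmod.mono fun t ht => hwx t ht) this
    simpa using h0.add hx
  exact _root_.mem_convexSubdiff_of_tendsto hP.continuous_g hwlim hy1
    (hmod.mono fun t ht => hwm t ht)

theorem isCritical_of_tendsto (hc : IsCompact (P.levelSet (x 0))) {U : Ultrafilter ℕ}
    (hU : (U : Filter ℕ) ≤ atTop) (hx : Tendsto x U (𝓝 xs)) (hy : Tendsto y U (𝓝 ys)) :
    P.IsCritical xs ∧ (P.F xs).toReal • ys ∈ (P.F xs).toReal • convexSubdiff P.g xs := by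
  obtain ⟨gbar, hgbar, hg⟩ := hP.exists_gbar hc
  have hf := feasible hP hαlo hσ hγ0 hxy
  have hxs : xs ∈ P.levelSet (x 0) := hc.isClosed.mem_of_tendsto hx
    (Eventually.of_forall (mem_levelSet hP hαlo hσ hγ0 hxy))
  have hdom := hP.levelSet_subset hxy.init_x hxs
  have hF := hP.F_eq hdom.1 hdom.2
  have hFtop : P.F xs < ⊤ := hP.F_lt_top_iff.2 hdom
  have hζ0 := hP.zetaR_nonneg_of_ne_top hdom.2 (hP.h_finite xs hdom.1)
  -- If `ζ xs = 0` then `xs` minimizes `ζ`, and the iteration plays no role. The condition on `ys`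
  -- is then `0 ∈ 0 • ∂g(xs)`, which needs `∂g(xs)` to be nonempty.
  rcases hζ0.eq_or_lt with h0 | hpos
  · obtain ⟨v, hv⟩ := convexSubdiff_nonempty hP.g_convex xs
    have hFz : (P.F xs).toReal = 0 := by rw [hF, ← h0, zero_div, EReal.toReal_coe]
    refine ⟨isCritical_of_mem hFtop (hP.neg_gradH_mem_frechetSubdiff hdom.1 hdom.2 h0.symm) hv
      (by rw [hFz, zero_smul, neg_add_cancel]), ?_⟩
    rw [hFz, zero_smul]
    exact ⟨v, hv, zero_smul ℝ v⟩
  obtain ⟨L, hL, -⟩ := exists_tendsto_qR hP hαlo hσ hγ0 hxy hc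
  have hηlim := tendsto_etaR hP hc U hx hy (mem_setY hP hαlo hσ hγ0 hxy hgbar hg)
  have hηpos : 0 < P.etaR xs ys := by
    obtain ⟨η₀, hη₀, hη⟩ := exists_pos_le_etaR hP hαlo hσ hγ0 hxy hc
    exact hη₀.trans_le (ge_of_tendsto hηlim (Eventually.of_forall hη))
  have hLeq : L = P.zetaR xs / P.etaR xs ys := by
    have hζlim : Tendsto (fun t => P.zetaR (x t)) U (𝓝 (P.zetaR xs)) :=
      (hP.continuousOn_zetaR xs hdom).tendsto.comp (tendsto_nhdsWithin_iff.2
        ⟨hx, Eventually.of_forall fun t => ⟨(hf t).mem_Omega, (hf t).dom⟩⟩)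
    exact tendsto_nhds_unique (hL.mono_left hU) (hζlim.div hηlim hηpos.ne')
  have hL0 : 0 < L := hLeq ▸ div_pos hpos hηpos
  have hdx := tendsto_x_sub hP hαlo hσ hγ0 hxy hc
  have hdy := tendsto_y_sub hP hαlo hσ hγ0 hxy hc hL0 hL
  have hres : ∀ k ≤ N, ∃ V : Ultrafilter ℕ, (V : Filter ℕ) ≤ atTop ∧ Tendsto x V (𝓝 xs) ∧
      Tendsto y V (𝓝 ys) ∧ ∀ᶠ t in (V : Filter ℕ), t % (N + 1) = k := by
    intro k hk
    obtain ⟨V, hV, hu, hm⟩ := exists_ultrafilter_mod_eq (u := fun t => (x t, y t))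
      (p := (xs, ys)) hk (hdx.prodMk_nhds hdy) hU (hx.prodMk_nhds hy)
    exact ⟨V, hV, (continuous_fst.tendsto _).comp hu, (continuous_snd.tendsto _).comp hu, hm⟩
  have hys : ys ∈ convexSubdiff P.g xs := by
    obtain ⟨V, hV, hxV, hyV, hm⟩ := hres 0 (Nat.zero_le N)
    exact mem_convexSubdiff_of_tendsto hP hαlo hσ hγ0 hxy hxV hyV (hdy.mono_left hV) hm
  have hFL : (P.F xs).toReal = L := by rw [hF, EReal.toReal_coe, hLeq, etaR_eq_of_mem hys]
  have hsub : -(P.gradH xs - L • ys) ∈ frechetSubdiff P.f xs := by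
    refine hP.neg_mem_frechetSubdiff hdom.2 fun i => ?_
    obtain ⟨V, hV, hxV, hyV, hm⟩ := hres (i.1 + 1) i.2
    exact exists_fblk_le hP hαlo hσ hγ0 hxy hc hxs hV hxV hyV (hL.mono_left hV) i hm
  exact ⟨isCritical_of_mem hFtop hsub hys (by rw [hFL]; abel), smul_mem_smul_set hys⟩

end IsCyclicMPGA
end Cluster
end FracProgram
end

open FracProgram IsCyclicMPGA in
theorem mainTheorem7 {n N : ℕ} (P : FracProgram n N) (hP : P.Standing)
    (αlo αhi σ γ : ℝ) (M : ℕ) (hαlo : 0 < αlo) (hα : αlo ≤ αhi) (hσ : 0 < σ)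
    (hγ0 : 0 < γ) (hγ1 : γ < 1)
    (x y : ℕ → EuclideanSpace ℝ (Fin n))
    (hxy : P.IsCyclicMPGA αlo αhi σ γ M x y)
    (hcompact : IsCompact (P.levelSet (x 0))) :
    0 < ⨅ t, P.eta (x t) (y t) ∧
    ∀ xs ys : EuclideanSpace ℝ (Fin n),
      MapClusterPt (xs, ys) atTop (fun t => (x t, y t)) →
        (∀ gbar : ℝ, 0 < gbar → (∀ u ∈ P.levelSet (x 0), P.g u ≤ gbar) →
          (xs, ys) ∈ P.setS (x 0) αlo gbar) ∧
        P.IsCritical xs ∧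
        (P.F xs).toReal • ys ∈ (P.F xs).toReal • convexSubdiff P.g xs := by
  have hf := feasible hP hαlo hσ hγ0 hxy
  obtain ⟨η₀, hη₀, hη⟩ := exists_pos_le_etaR hP hαlo hσ hγ0 hxy hcompact
  refine ⟨lt_of_lt_of_le (EReal.coe_pos.2 hη₀) (le_iInf fun t => ?_), fun xs ys hcl => ?_⟩
  · rw [(hf t).eta_eq]
    exact EReal.coe_le_coe_iff.2 (hη t)
  obtain ⟨U, hU, hlim⟩ := mapClusterPt_iff_ultrafilter.1 hcl
  have hx : Tendsto x U (𝓝 xs) := (continuous_fst.tendsto _).comp hlim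
  have hy : Tendsto y U (𝓝 ys) := (continuous_snd.tendsto _).comp hlim
  refine ⟨fun gbar hgbar hg => ?_, isCritical_of_tendsto hP hαlo hσ hγ0 hxy hcompact hU hx hy⟩
  have hmem := mem_setY hP hαlo hσ hγ0 hxy hgbar hg
  have hys := mem_setY_of_tendsto hP hcompact U hy hmem
  obtain ⟨w, -, hw⟩ := mem_iUnion₂.1 hys
  refine ⟨hcompact.isClosed.mem_of_tendsto hx
    (Eventually.of_forall (mem_levelSet hP hαlo hσ hγ0 hxy)), hys, ?_⟩
  rw [eta_eq hw]
  exact EReal.coe_pos.2 (hη₀.trans_le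
    (ge_of_tendsto (tendsto_etaR hP hcompact U hx hy hmem) (Eventually.of_forall hη)))
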